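/- Let $\mathcal S,\mathcal A$ be finite nonempty sets and $\gamma\in(0,1)$. A policy is a map $\pi:\mathcal S\to\Delta(\mathcal A)$; let $\Pi$ be the set of policies and $\|\pi-\pi'\|_\infty=\max_{s,a}|\pi(a|s)-\pi'(a|s)|$. A performative Markov decision process (PeMDP) assigns to every $\pi\in\Pi$ a transition kernel $P_\pi(\cdot|s,a)\in\Delta(\mathcal S)$ and a reward $r_\pi(s,a)\in\mathbb R$. For an initial distribution $\rho\in\Delta(\mathcal S)$ let $\mathbb E^{\pi}_{\pi',\rho}$ be the expectation over $s_0\sim\rho$, $a_t\sim\pi(\cdot|s_t)$, $s_{t+1}\sim P_{\pi'}(\cdot|s_t,a_t)$, and put $$V(\pi)=\mathbb E^{\pi}_{\pi,\rho}\Big[\sum_{t\ge0}\gamma^t r_\pi(s_t,a_t)\Big],\qquad \tilde V_\lambda(\pi)=\mathbb E^{\pi}_{\pi,\rho}\Big[\sum_{t\ge0}\gamma^t\big(r_\pi(s_t,a_t)-\lambda\log\pi(a_t|s_t)\big)\Big],$$ $$d^{\pi}_{\pi',\nu}(s,a)=(1-\gamma)\,\mathbb E^{\pi}_{\pi',\nu}\Big[\sum_{t\ge0}\gamma^t\mathbf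 1\{s_t=s,a_t=a\}\Big].$$ Assume that for constants $R_{\max}>0$ and $L_r,L_P,R_2,T_2\ge0$, and all $\pi,\pi'\in\Pi$: $|r_\pi(s,a)|\le R_{\max}$ for all $s,a$; $\|r_\pi-r_{\pi'}\|_1\le L_r\|\pi-\pi'\|_\infty$ and $\|P_\pi-P_{\pi'}\|_1\le L_P\|\pi-\pi'\|_\infty$; $r$ and $P$ are differentiable in $\pi$ on $\Pi$ with gradients satisfying $\|\nabla_\pi r_\pi-\nabla_{\pi'}r_{\pi'}\|_1\le R_2\|\pi-\pi'\|_\infty$ and $\|\nabla_\pi P_\pi-\nabla_{\pi'}P_{\pi'}\|_1\le T_2\|\pi-\pi'\|_\infty$. Here $\|\cdot\|_1$ is the entrywise $\ell^1$ norm for $r$, and for $P$ it is the $\ell^1$ norm of the row belonging to $(s,a)$, maximised over $(s,a)$. Let $\pi_\theta(a|s)=e^{\theta_{s,a}}/\sum_{a'}e^{\theta_{s,a'}}$, $\theta\in\mathbb R^{\mathcal S\times\mathcal A}$, be the softmax policies. For an objective $J\in\{V,\tilde V_\lambda\}$, a maximiser $\pi^\star$ of $J$ over $\Pi$ and any $\theta_0$,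 run gradient ascent $\theta_{t+1}=\theta_t+\eta\nabla_\theta J(\pi_\theta)|_{\theta=\theta_t}$ and write $\mathrm{SubOpt}_J(\pi)=J(\pi^\star)-J(\pi)$. Let $$\mathsf{Cov}=\sup_{\theta\in\Theta,\ \nu\in N}\Big\|\frac{d^{\pi^\star}_{\pi_\theta,\rho}}{d^{\pi_\theta}_{\pi_\theta,\nu}}\Big\|_\infty ,$$ where $\Theta$ is a set of parameters containing $\theta_0,\dots,\theta_{T-1}$ and $N$ is a set of initial distributions containing $\rho$, and suppose $\mathsf{Cov}<\infty$. There is a constant $c>0$ depending only on $R_{\max},L_r,L_P,R_2,T_2$, and for each $\kappa\in(0,c]$ a constant $C>0$ depending only on $\kappa$ and these five constants, such that for $\eta=\kappa(1-\gamma)^2/|\mathcal A|$, every $\epsilon>0$ and every integer $$T\ \ge\ \max\Big\{1,\ C\,\frac{|\mathcal S||\mathcal A|^2\,\mathsf{Cov}^2}{\epsilon^2(1-\gamma)^3}\Big\}:$$ (a) for $J=V$, $$\min_{t<T}\mathrm{SubOpt}_J(\pi_{\theta_t})\le\epsilon+\frac{\sqrt2\,(1+\mathsf{Cov})}{(1-\gamma)^2}\big(L_r+L_PR_{\max}\big);$$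 (b) for $J=\tilde V_\lambda$ with $\lambda=\frac{(1-\gamma)R_{\max}}{1+2\log|\mathcal A|}$, $$\min_{t<T}\mathrm{SubOpt}_J(\pi_{\theta_t})\le\epsilon+\frac{\sqrt2\,(2+\mathsf{Cov})}{(1-\gamma)^2}\big(L_r+L_P(R_{\max}+\lambda\log|\mathcal A|)\big).$$ In both cases $\mathsf{Cov}\ge1$, so the bias is $O(\mathsf{Cov}/(1-\gamma)^2)$. -/

import Mathlib

open scoped ENNReal

/-- The set of (stationary, stochastic) policies `π : S → Δ(A)`, with `π s a = π(a | s)`, as a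
subset of `ℝ^(S × A)`. The norm of `S → A → ℝ` is the sup norm over all pairs `(s, a)`. -/
def Policies (S A : Type*) [Fintype A] : Set (S → A → ℝ) :=
  {π | ∀ s, π s ∈ stdSimplex ℝ A}

/-- A performative Markov decision process on finite state and action spaces: the transition
kernel `trans π s a s' = P_π(s' | s, a)` and the reward `reward π s a = r_π(s, a)` depend on the
deployed policy `π`. (The values at functions `π` that are not policies play no role.) -/
structure PeMDP (S A : Type*) [Fintype S] [Fintype A] where
  trans : (S → A → ℝ) → S → A → S → ℝ
  reward : (S → A → ℝ) → S → A → ℝ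
  discount : ℝ
  discount_pos : 0 < discount
  discount_lt_one : discount < 1
  trans_mem : ∀ π ∈ Policies S A, ∀ s a, trans π s a ∈ stdSimplex ℝ S

/-- The law of the state `s_t` when `s_0 ∼ ρ`, `a_t ∼ π(· | s_t)`, `s_{t+1} ∼ P(· | s_t, a_t)`. -/
def stateLaw {S A : Type*} [Fintype S] [Fintype A] (P : S → A → S → ℝ) (π : S → A → ℝ)
    (ρ : S → ℝ) : ℕ → S → ℝ
  | 0 => ρ
  | t + 1 => fun s' => ∑ s, ∑ a, stateLaw P π ρ t s * π s a * P s a s'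

/-- The expected discounted return `E[∑_t γ^t f(s_t, a_t)]` of the reward function `f` along the
trajectory `s_0 ∼ ρ`, `a_t ∼ π(· | s_t)`, `s_{t+1} ∼ P(· | s_t, a_t)`. -/
noncomputable def discountedReturn {S A : Type*} [Fintype S] [Fintype A] (γ : ℝ)
    (P : S → A → S → ℝ) (π : S → A → ℝ) (f : S → A → ℝ) (ρ : S → ℝ) : ℝ :=
  ∑' t : ℕ, γ ^ t * ∑ s, ∑ a, stateLaw P π ρ t s * π s a * f s a

namespace PeMDP

variable {S A : Type*} [Fintype S] [Fintype A]

/-- The performative value function `V_π^π(ρ)`. -/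
noncomputable def value (M : PeMDP S A) (ρ : S → ℝ) (π : S → A → ℝ) : ℝ :=
  discountedReturn M.discount (M.trans π) π (M.reward π) ρ

/-- The entropy-regularised (soft) performative value function, for the soft reward
`r_π(s, a) - lam * log π(a | s)`. -/
noncomputable def softValue (M : PeMDP S A) (lam : ℝ) (ρ : S → ℝ) (π : S → A → ℝ) : ℝ :=
  discountedReturn M.discount (M.trans π) π
    (fun s a => M.reward π s a - lam * Real.log (π s a)) ρ

/-- The state-action occupancy measure `d_{π', ρ}^π (s, a)` of the policy `π` played in the
environment induced by `π'`:
`(1 - γ) E[∑_t γ^t 1(s_t = s, a_t = a)]`. -/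
noncomputable def occupancy (M : PeMDP S A) (π' π : S → A → ℝ) (ρ : S → ℝ) (s : S) (a : A) : ℝ :=
  (1 - M.discount) * ∑' t : ℕ, M.discount ^ t * (stateLaw (M.trans π') π ρ t s * π s a)

end PeMDP

/-- The softmax policy `π_θ(a | s) = exp θ_{s,a} / ∑_{a'} exp θ_{s,a'}`. -/
noncomputable def softmaxPolicy {S A : Type*} [Fintype A] (θ : EuclideanSpace ℝ (S × A)) :
    S → A → ℝ :=
  fun s a => Real.exp (θ (s, a)) / ∑ a', Real.exp (θ (s, a'))

/-- The linear form `h ↦ ∑_{s,a} g(s, a) h(s, a)` on `ℝ^(S × A)`. -/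
noncomputable def gradForm {S A : Type*} [Fintype S] [Fintype A] (g : S → A → ℝ) :
    (S → A → ℝ) →L[ℝ] ℝ :=
  ∑ s, ∑ a, g s a •
    (ContinuousLinearMap.proj (R := ℝ) (φ := fun _ : A => ℝ) a).comp
      (ContinuousLinearMap.proj (R := ℝ) (φ := fun _ : S => A → ℝ) s)

/-- `g = (∂f / ∂π(a | s))_{s,a}` is a gradient at the policy `π` of the function `f` of the policy;
`f` is differentiated within the set of policies. -/
def HasPolicyGradientAt {S A : Type*} [Fintype S] [Fintype A] (f : (S → A → ℝ) → ℝ)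
    (g : S → A → ℝ) (π : S → A → ℝ) : Prop :=
  HasFDerivWithinAt f (gradForm g) (Policies S A) π

namespace PeMDP

variable {S A : Type*} [Fintype S] [Fintype A]

/-- Rewards bounded by `Rmax`, and rewards and transitions that are Lipschitz (constants `Lr`, `Lp`)
and smooth (constants `R2`, `T2`) functions of the policy, from the sup norm to the `ℓ¹` norm.
For transition kernels the `ℓ¹` norm is that of `P(· | s, a)`, uniformly in `(s, a)`. -/
structure IsSmooth (M : PeMDP S A) (Rmax Lr Lp R2 T2 : ℝ) : Prop where
  reward_bounded : ∀ π ∈ Policies S A, ∀ s a, |M.reward π s a| ≤ Rmax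
  reward_lipschitz : ∀ π ∈ Policies S A, ∀ π' ∈ Policies S A,
    ∑ s, ∑ a, |M.reward π s a - M.reward π' s a| ≤ Lr * ‖π - π'‖
  trans_lipschitz : ∀ π ∈ Policies S A, ∀ π' ∈ Policies S A, ∀ s a,
    ∑ s', |M.trans π s a s' - M.trans π' s a s'| ≤ Lp * ‖π - π'‖
  reward_smooth : ∃ G : (S → A → ℝ) → S → A → (S → A → ℝ),
    (∀ π ∈ Policies S A, ∀ s a,
      HasPolicyGradientAt (fun π => M.reward π s a) (G π s a) π) ∧
    ∀ π ∈ Policies S A, ∀ π' ∈ Policies S A,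
      ∑ s, ∑ a, ∑ x, ∑ b, |G π s a x b - G π' s a x b| ≤ R2 * ‖π - π'‖
  trans_smooth : ∃ G : (S → A → ℝ) → S → A → S → (S → A → ℝ),
    (∀ π ∈ Policies S A, ∀ s a s',
      HasPolicyGradientAt (fun π => M.trans π s a s') (G π s a s') π) ∧
    ∀ π ∈ Policies S A, ∀ π' ∈ Policies S A, ∀ s a,
      ∑ s', ∑ x, ∑ b, |G π s a s' x b - G π' s a s' x b| ≤ T2 * ‖π - π'‖

/-- Exact gradient ascent `θ_{t+1} = θ_t + η ∇_θ J(π_θ)|_{θ = θ_t}` over softmax policies, for the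
objective `J`. -/
noncomputable def gradientAscent (J : (S → A → ℝ) → ℝ) (η : ℝ)
    (θ₀ : EuclideanSpace ℝ (S × A)) : ℕ → EuclideanSpace ℝ (S × A)
  | 0 => θ₀
  | t + 1 => gradientAscent J η θ₀ t +
      η • gradient (fun θ => J (softmaxPolicy θ)) (gradientAscent J η θ₀ t)

/-- The coverage `max_{θ, ν} ‖ d_{π_θ, ρ}^{π⋆} / d_{π_θ, ν}^{π_θ} ‖_∞`, over parameters `θ ∈ Θ` and
initial distributions `ν ∈ N`, as an extended nonnegative number (`x / 0 = ∞` for `x > 0`, and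
`0 / 0 = 0`). -/
noncomputable def coverage (M : PeMDP S A) (ρ : S → ℝ) (πstar : S → A → ℝ)
    (Θ : Set (EuclideanSpace ℝ (S × A))) (N : Set (S → ℝ)) : ℝ≥0∞ :=
  ⨆ θ ∈ Θ, ⨆ ν ∈ N, ⨆ s, ⨆ a,
    ENNReal.ofReal (M.occupancy (softmaxPolicy θ) πstar ρ s a) /
      ENNReal.ofReal (M.occupancy (softmaxPolicy θ) (softmaxPolicy θ) ν s a)

end PeMDP

/-! Write g = 1 - γ. The unregularised value is the soft value with λ = 0, so only the soft value is
treated. The proof joins a gradient domination inequality to a smoothness bound for θ ↦ J(π_θ) with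
a sharp power of the horizon 1/g, after a dichotomy on how strongly the environment reacts to the
policy.

Dichotomy: if L_r > 3 R_max g or L_P > 3 g, the bias term is already at least 3 R_max / g, which
bounds the range of the objective, so the initial parameter will do. Otherwise the process is mild
(`PeMDP.IsMild`).

Gradient domination (`PeMDP.softValue_sub_le`) needs no mildness. Moving π⋆ into the environment of
π_θ costs a Lipschitz error. There the performance difference identity and Gibbs' inequality bound
the gap by the advantages of π_θ summed against the occupancy of π⋆. Rewritten under the occupancy
of π_θ, this sum is the derivative of J in the direction u, the ratio of the two occupancies, minus
the part of the derivative that comes from the moving environment; that part is again a Lipschitz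
error, multiplied by Cov. Since 0 ≤ u ≤ Cov, one has ‖u‖² ≤ |S||A| Cov².

Smoothness: a step of order g²/|A| requires a second-order remainder of order |A|/g², whereas sup
bounds on the change of the visitation measure give |A|/g³. The missing factor comes from
`sum_visitation_sq_advantage_le`, a variance bound for advantages. It is used once for the value
function and once for the Bellman solution whose reward is the first variation of the value;
Cauchy-Schwarz then controls the interaction of the policy change with this solution
(`PeMDP.IsMild.abs_sum_visitation_firstVariation_le`). The contribution of the moving kernel is
affordable because L_P = O(g). What is left is a cubic term with a worse power of g, and
`abs_remainder_le_of_local` removes it by repeated bisection.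

Conclusion: the ascent inequality produces an iterate with ‖∇J‖² ≤ 6 R_max |A| / (κ g³ T), and
pairing ∇J with u gives at most ε for the prescribed T. -/

set_option linter.unusedSectionVars false

/-! ### Discounted visitation, Bellman equations and second moments of advantages -/

section Discounted

variable {S A : Type*} [Fintype S] [Fintype A]

/-- The expectation `∑_a π(a | s) y(s, a)`. -/
def actionMean (π : S → A → ℝ) (y : S → A → ℝ) (s : S) : ℝ := ∑ a, π s a * y s a

/-- The expectation of `x` at the next state, `∑_{s'} P(s' | s, a) x(s')`. -/
def lookahead (P : S → A → S → ℝ) (x : S → ℝ) (s : S) (a : A) : ℝ := ∑ s', P s a s' * x s'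

/-- The (unnormalised) discounted visitation measure of the states. -/
noncomputable def visitation (γ : ℝ) (P : S → A → S → ℝ) (π : S → A → ℝ) (ρ : S → ℝ) (s : S) : ℝ :=
  ∑' t : ℕ, γ ^ t * stateLaw P π ρ t s

/-- The discounted return as a function of the initial state. -/
noncomputable def returnFrom (γ : ℝ) (P : S → A → S → ℝ) (π : S → A → ℝ) (f : S → A → ℝ)
    [DecidableEq S] (s : S) : ℝ :=
  discountedReturn γ P π f (Pi.single s 1)

lemma actionMean_add (π y z : S → A → ℝ) (s : S) :
    actionMean π (fun s a => y s a + z s a) s = actionMean π y s + actionMean π z s := by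
  simp [actionMean, mul_add, Finset.sum_add_distrib]

lemma actionMean_sub (π y z : S → A → ℝ) (s : S) :
    actionMean π (fun s a => y s a - z s a) s = actionMean π y s - actionMean π z s := by
  simp [actionMean, mul_sub, Finset.sum_sub_distrib]

lemma actionMean_smul (π y : S → A → ℝ) (c : ℝ) (s : S) :
    actionMean π (fun s a => c * y s a) s = c * actionMean π y s := by
  simp only [actionMean, Finset.mul_sum]
  exact Finset.sum_congr rfl fun a _ => by ring

lemma actionMean_const {π : S → A → ℝ} (hπ : π ∈ Policies S A) (x : S → ℝ) (s : S) :
    actionMean π (fun s _ => x s) s = x s := by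
  simp [actionMean, ← Finset.sum_mul, (hπ s).2]

lemma actionMean_mono {π : S → A → ℝ} (hπ : π ∈ Policies S A) {y z : S → A → ℝ} {s : S}
    (h : ∀ a, y s a ≤ z s a) : actionMean π y s ≤ actionMean π z s :=
  Finset.sum_le_sum fun a _ => mul_le_mul_of_nonneg_left (h a) ((hπ s).1 a)

lemma abs_actionMean_le {π : S → A → ℝ} (hπ : π ∈ Policies S A) {y : S → A → ℝ} {s : S} {c : ℝ}
    (h : ∀ a, |y s a| ≤ c) : |actionMean π y s| ≤ c := by
  have h1 := actionMean_mono hπ (y := y) (z := fun _ _ => c) (s := s) fun a => (abs_le.1 (h a)).2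
  have h2 := actionMean_mono hπ (y := fun _ _ => -c) (z := y) (s := s) fun a => (abs_le.1 (h a)).1
  rw [actionMean_const hπ (fun _ => c)] at h1
  rw [actionMean_const hπ (fun _ => -c)] at h2
  exact abs_le.2 ⟨h2, h1⟩

lemma abs_lookahead_le {P : S → A → S → ℝ} {x : S → ℝ} {c d : ℝ} {s : S} {a : A}
    (hP : ∑ s', |P s a s'| ≤ d) (hc : 0 ≤ c) (hx : ∀ s, |x s| ≤ c) : |lookahead P x s a| ≤ d * c := by
  refine (Finset.abs_sum_le_sum_abs _ _).trans ?_
  calc ∑ s', |P s a s' * x s'| ≤ ∑ s', |P s a s'| * c := by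
        refine Finset.sum_le_sum fun s' _ => ?_
        rw [abs_mul]
        exact mul_le_mul_of_nonneg_left (hx s') (abs_nonneg _)
    _ = (∑ s', |P s a s'|) * c := by rw [Finset.sum_mul]
    _ ≤ d * c := mul_le_mul_of_nonneg_right hP hc

lemma sum_abs_of_mem_stdSimplex {ι : Type*} [Fintype ι] {p : ι → ℝ} (hp : p ∈ stdSimplex ℝ ι) :
    ∑ i, |p i| = 1 := by
  rw [← hp.2]
  exact Finset.sum_congr rfl fun i _ => abs_of_nonneg (hp.1 i)

lemma stateLaw_mem {P : S → A → S → ℝ} {π : S → A → ℝ} {ρ : S → ℝ}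
    (hP : ∀ s a, P s a ∈ stdSimplex ℝ S) (hπ : π ∈ Policies S A) (hρ : ρ ∈ stdSimplex ℝ S) (t : ℕ) :
    stateLaw P π ρ t ∈ stdSimplex ℝ S := by
  induction t with
  | zero => exact hρ
  | succ t ih =>
    refine ⟨fun s' => Finset.sum_nonneg fun s _ => Finset.sum_nonneg fun a _ =>
      mul_nonneg (mul_nonneg (ih.1 s) ((hπ s).1 a)) ((hP s a).1 s'), ?_⟩
    simp only [stateLaw]
    rw [Finset.sum_comm]
    rw [← ih.2]
    refine Finset.sum_congr rfl fun s _ => ?_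
    rw [Finset.sum_comm]
    simp_rw [← Finset.mul_sum, (hP s _).2, mul_one, ← Finset.mul_sum, (hπ s).2, mul_one]

lemma sum_stateLaw_succ (P : S → A → S → ℝ) (π : S → A → ℝ) (ρ x : S → ℝ) (t : ℕ) :
    ∑ s, stateLaw P π ρ (t + 1) s * x s =
      ∑ s, stateLaw P π ρ t s * actionMean π (lookahead P x) s := by
  simp only [stateLaw, actionMean, lookahead, Finset.sum_mul, Finset.mul_sum]
  rw [Finset.sum_comm]
  refine Finset.sum_congr rfl fun s _ => ?_
  rw [Finset.sum_comm]
  exact Finset.sum_congr rfl fun a _ => Finset.sum_congr rfl fun s' _ => by ring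

variable {γ : ℝ} {P : S → A → S → ℝ} {π : S → A → ℝ} {ρ : S → ℝ}

lemma summable_stateLaw (hγ0 : 0 ≤ γ) (hγ1 : γ < 1) (hP : ∀ s a, P s a ∈ stdSimplex ℝ S)
    (hπ : π ∈ Policies S A) (hρ : ρ ∈ stdSimplex ℝ S) (s : S) :
    Summable fun t => γ ^ t * stateLaw P π ρ t s := by
  refine Summable.of_nonneg_of_le (fun t => ?_) (fun t => ?_)
    (summable_geometric_of_lt_one hγ0 hγ1)
  · exact mul_nonneg (pow_nonneg hγ0 t) ((stateLaw_mem hP hπ hρ t).1 s)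
  · refine mul_le_of_le_one_right (pow_nonneg hγ0 t) ?_
    have h := stateLaw_mem hP hπ hρ t
    rw [← h.2]
    exact Finset.single_le_sum (fun i _ => h.1 i) (Finset.mem_univ s)

lemma visitation_nonneg (hγ0 : 0 ≤ γ) (hP : ∀ s a, P s a ∈ stdSimplex ℝ S)
    (hπ : π ∈ Policies S A) (hρ : ρ ∈ stdSimplex ℝ S) (s : S) : 0 ≤ visitation γ P π ρ s :=
  tsum_nonneg fun t => mul_nonneg (pow_nonneg hγ0 t) ((stateLaw_mem hP hπ hρ t).1 s)

lemma hasSum_visitation (hγ0 : 0 ≤ γ) (hγ1 : γ < 1) (hP : ∀ s a, P s a ∈ stdSimplex ℝ S)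
    (hπ : π ∈ Policies S A) (hρ : ρ ∈ stdSimplex ℝ S) (x : S → ℝ) :
    HasSum (fun t => γ ^ t * ∑ s, stateLaw P π ρ t s * x s) (∑ s, visitation γ P π ρ s * x s) := by
  have := hasSum_sum (s := Finset.univ) fun s _ =>
    ((summable_stateLaw hγ0 hγ1 hP hπ hρ s).hasSum.mul_right (x s))
  simpa only [visitation, Finset.mul_sum, mul_assoc] using this

lemma discountedReturn_eq (hγ0 : 0 ≤ γ) (hγ1 : γ < 1) (hP : ∀ s a, P s a ∈ stdSimplex ℝ S)
    (hπ : π ∈ Policies S A) (hρ : ρ ∈ stdSimplex ℝ S) (f : S → A → ℝ) :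
    discountedReturn γ P π f ρ = ∑ s, visitation γ P π ρ s * actionMean π f s := by
  rw [← (hasSum_visitation hγ0 hγ1 hP hπ hρ _).tsum_eq]
  simp only [discountedReturn, actionMean, Finset.mul_sum, mul_assoc]

/-- The discounted flow equation: one step of the chain shifts the series by one index, so
everything cancels except the term at time zero. -/
lemma sum_visitation_mul_sub (hγ0 : 0 ≤ γ) (hγ1 : γ < 1) (hP : ∀ s a, P s a ∈ stdSimplex ℝ S)
    (hπ : π ∈ Policies S A) (hρ : ρ ∈ stdSimplex ℝ S) (x : S → ℝ) :
    ∑ s, visitation γ P π ρ s * (x s - γ * actionMean π (lookahead P x) s) = ∑ s, ρ s * x s := by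
  have h1 := hasSum_visitation hγ0 hγ1 hP hπ hρ x
  have h2 := (hasSum_visitation hγ0 hγ1 hP hπ hρ (actionMean π (lookahead P x))).mul_left γ
  have h3 := h1.tsum_eq
  rw [h1.summable.tsum_eq_zero_add] at h3
  have h4 : ∀ t, γ * (γ ^ t * ∑ s, stateLaw P π ρ t s * actionMean π (lookahead P x) s) =
      γ ^ (t + 1) * ∑ s, stateLaw P π ρ (t + 1) s * x s := fun t => by
    rw [sum_stateLaw_succ]; ring
  simp_rw [h4] at h2
  rw [h2.tsum_eq] at h3
  simp only [mul_sub, Finset.sum_sub_distrib]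
  rw [← h3]
  simp only [stateLaw, Finset.mul_sum, pow_zero, one_mul]
  rw [sub_eq_iff_eq_add]
  congr 1
  exact Finset.sum_congr rfl fun s _ => by ring

lemma sum_visitation [Nonempty S] (hγ0 : 0 ≤ γ) (hγ1 : γ < 1)
    (hP : ∀ s a, P s a ∈ stdSimplex ℝ S)
    (hπ : π ∈ Policies S A) (hρ : ρ ∈ stdSimplex ℝ S) :
    ∑ s, visitation γ P π ρ s = 1 / (1 - γ) := by
  have h := sum_visitation_mul_sub hγ0 hγ1 hP hπ hρ (fun _ => 1)
  have h1 : lookahead P (fun _ => (1 : ℝ)) = fun _ _ => 1 := by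
    funext s a; simp [lookahead, (hP s a).2]
  simp only [h1, actionMean_const hπ (fun _ => (1 : ℝ)), mul_one, hρ.2, ← Finset.sum_mul] at h
  rw [eq_div_iff (by linarith), h]

lemma sum_visitation_mul_le [Nonempty S] (hγ0 : 0 ≤ γ) (hγ1 : γ < 1)
    (hP : ∀ s a, P s a ∈ stdSimplex ℝ S)
    (hπ : π ∈ Policies S A) (hρ : ρ ∈ stdSimplex ℝ S) {y : S → ℝ} {c : ℝ} (h : ∀ s, y s ≤ c) :
    ∑ s, visitation γ P π ρ s * y s ≤ c / (1 - γ) := by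
  calc ∑ s, visitation γ P π ρ s * y s ≤ ∑ s, visitation γ P π ρ s * c :=
        Finset.sum_le_sum fun s _ =>
          mul_le_mul_of_nonneg_left (h s) (visitation_nonneg hγ0 hP hπ hρ s)
    _ = c / (1 - γ) := by
        rw [← Finset.sum_mul, sum_visitation hγ0 hγ1 hP hπ hρ]; ring

lemma abs_sum_visitation_mul_le [Nonempty S] (hγ0 : 0 ≤ γ) (hγ1 : γ < 1)
    (hP : ∀ s a, P s a ∈ stdSimplex ℝ S)
    (hπ : π ∈ Policies S A) (hρ : ρ ∈ stdSimplex ℝ S) {y : S → ℝ} {c : ℝ} (h : ∀ s, |y s| ≤ c) :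
    |∑ s, visitation γ P π ρ s * y s| ≤ c / (1 - γ) := by
  refine abs_le'.2 ⟨sum_visitation_mul_le hγ0 hγ1 hP hπ hρ fun s => (abs_le.1 (h s)).2, ?_⟩
  rw [← Finset.sum_neg_distrib]
  simp_rw [← mul_neg]
  exact sum_visitation_mul_le hγ0 hγ1 hP hπ hρ fun s => by linarith [(abs_le.1 (h s)).1]

/-- Maximum principle: at a state where |x| is largest, averaging over the next state cannot
increase it. -/
lemma abs_le_of_bellman [Nonempty S] (hγ0 : 0 ≤ γ) (hγ1 : γ < 1)
    (hP : ∀ s a, P s a ∈ stdSimplex ℝ S) (hπ : π ∈ Policies S A) {x w : S → ℝ} {c : ℝ}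
    (hx : ∀ s, x s = w s + γ * actionMean π (lookahead P x) s) (hw : ∀ s, |w s| ≤ c) (s : S) :
    |x s| ≤ c / (1 - γ) := by
  obtain ⟨s₀, hs₀⟩ := Finite.exists_max fun s => |x s|
  have h1 : |actionMean π (lookahead P x) s₀| ≤ |x s₀| := by
    refine abs_actionMean_le hπ fun a => ?_
    have := abs_lookahead_le (P := P) (s := s₀) (a := a) (sum_abs_of_mem_stdSimplex (hP s₀ a)).le
      (abs_nonneg (x s₀)) hs₀
    simpa using this
  have h2 : |x s₀| ≤ c + γ * |x s₀| := by
    calc |x s₀| = |w s₀ + γ * actionMean π (lookahead P x) s₀| := by rw [← hx s₀]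
      _ ≤ |w s₀| + |γ * actionMean π (lookahead P x) s₀| := abs_add_le _ _
      _ ≤ c + γ * |x s₀| := by
        rw [abs_mul, abs_of_nonneg hγ0]
        exact add_le_add (hw s₀) (mul_le_mul_of_nonneg_left h1 hγ0)
  refine (hs₀ s).trans ?_
  rw [le_div_iff₀ (by linarith)]
  linarith

/-- The maximum principle makes x ↦ x - γ P_π x injective, hence surjective in finite dimension. The
solutions serve as dual test functions for differences of visitation measures. -/
lemma exists_bellman [Nonempty S] (hγ0 : 0 ≤ γ) (hγ1 : γ < 1)
    (hP : ∀ s a, P s a ∈ stdSimplex ℝ S) (hπ : π ∈ Policies S A) (w : S → ℝ) :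
    ∃ x : S → ℝ, ∀ s, x s = w s + γ * actionMean π (lookahead P x) s := by
  let T : (S → ℝ) →ₗ[ℝ] (S → ℝ) :=
    { toFun := fun x s => x s - γ * actionMean π (lookahead P x) s
      map_add' := fun x y => by
        funext s
        simp only [Pi.add_apply, actionMean, lookahead, mul_add, Finset.sum_add_distrib]
        ring
      map_smul' := fun r x => by
        funext s
        simp only [Pi.smul_apply, smul_eq_mul, RingHom.id_apply, actionMean, lookahead,
          Finset.mul_sum, mul_sub]
        congr 1
        exact Finset.sum_congr rfl fun a _ => Finset.sum_congr rfl fun s' _ => by ring }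
  have hT : Function.Injective T := by
    rw [← LinearMap.ker_eq_bot, LinearMap.ker_eq_bot']
    intro x hx
    funext s
    have h := abs_le_of_bellman (w := fun _ => 0) (c := 0) hγ0 hγ1 hP hπ (x := x) (fun s => by
      have h := congrFun hx s
      have h' : x s - γ * actionMean π (lookahead P x) s = 0 := h
      linarith) (fun s => by simp) s
    simpa using h
  obtain ⟨x, hx⟩ := LinearMap.injective_iff_surjective.1 hT w
  refine ⟨x, fun s => ?_⟩
  have h' : x s - γ * actionMean π (lookahead P x) s = w s := congrFun hx s
  linarith

/-- Performance difference identity for an arbitrary comparison function x. Since x need not be a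
value function of the same policy or kernel, it compares policies and environments alike. -/
lemma discountedReturn_sub (hγ0 : 0 ≤ γ) (hγ1 : γ < 1) (hP : ∀ s a, P s a ∈ stdSimplex ℝ S)
    (hπ : π ∈ Policies S A) (hρ : ρ ∈ stdSimplex ℝ S) (f : S → A → ℝ) (x : S → ℝ) :
    discountedReturn γ P π f ρ - ∑ s, ρ s * x s = ∑ s, visitation γ P π ρ s *
      (actionMean π (fun s a => f s a + γ * lookahead P x s a) s - x s) := by
  rw [discountedReturn_eq hγ0 hγ1 hP hπ hρ, ← sum_visitation_mul_sub hγ0 hγ1 hP hπ hρ x,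
    ← Finset.sum_sub_distrib]
  refine Finset.sum_congr rfl fun s _ => ?_
  rw [actionMean_add, actionMean_smul]
  ring

lemma discountedReturn_eq_of_bellman (hγ0 : 0 ≤ γ) (hγ1 : γ < 1)
    (hP : ∀ s a, P s a ∈ stdSimplex ℝ S)
    (hπ : π ∈ Policies S A) (hρ : ρ ∈ stdSimplex ℝ S) {f : S → A → ℝ} {x : S → ℝ}
    (hx : ∀ s, x s = actionMean π (fun s a => f s a + γ * lookahead P x s a) s) :
    discountedReturn γ P π f ρ = ∑ s, ρ s * x s := by
  rw [← sub_eq_zero, discountedReturn_sub hγ0 hγ1 hP hπ hρ f x]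
  exact Finset.sum_eq_zero fun s _ => by rw [← hx s]; simp

lemma returnFrom_eq [DecidableEq S] [Nonempty S] (hγ0 : 0 ≤ γ) (hγ1 : γ < 1)
    (hP : ∀ s a, P s a ∈ stdSimplex ℝ S) (hπ : π ∈ Policies S A) (f : S → A → ℝ) (s : S) :
    returnFrom γ P π f s =
      actionMean π (fun s a => f s a + γ * lookahead P (returnFrom γ P π f) s a) s := by
  obtain ⟨x, hx⟩ := exists_bellman hγ0 hγ1 hP hπ (actionMean π f)
  have hx' : ∀ s, x s = actionMean π (fun s a => f s a + γ * lookahead P x s a) s := fun s => by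
    rw [actionMean_add, actionMean_smul]; exact hx s
  have h : returnFrom γ P π f = x := by
    funext s
    rw [returnFrom, discountedReturn_eq_of_bellman hγ0 hγ1 hP hπ (single_mem_stdSimplex ℝ s) hx']
    simp [Pi.single_apply]
  rw [h]; exact hx' s

lemma abs_returnFrom_le [DecidableEq S] [Nonempty S] (hγ0 : 0 ≤ γ) (hγ1 : γ < 1)
    (hP : ∀ s a, P s a ∈ stdSimplex ℝ S) (hπ : π ∈ Policies S A) {f : S → A → ℝ} {c : ℝ}
    (hf : ∀ s, |actionMean π f s| ≤ c) (s : S) : |returnFrom γ P π f s| ≤ c / (1 - γ) :=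
  abs_le_of_bellman (w := actionMean π f) hγ0 hγ1 hP hπ (fun s => by
    rw [← actionMean_smul, ← actionMean_add]; exact returnFrom_eq hγ0 hγ1 hP hπ f s) hf s

lemma discountedReturn_eq_sum_returnFrom [DecidableEq S] [Nonempty S] (hγ0 : 0 ≤ γ) (hγ1 : γ < 1)
    (hP : ∀ s a, P s a ∈ stdSimplex ℝ S)
    (hπ : π ∈ Policies S A) (hρ : ρ ∈ stdSimplex ℝ S) (f : S → A → ℝ) :
    discountedReturn γ P π f ρ = ∑ s, ρ s * returnFrom γ P π f s :=
  discountedReturn_eq_of_bellman hγ0 hγ1 hP hπ hρ fun s => returnFrom_eq hγ0 hγ1 hP hπ f s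

lemma sq_lookahead_le (hP : ∀ s a, P s a ∈ stdSimplex ℝ S) (x : S → ℝ) (s : S) (a : A) :
    lookahead P x s a ^ 2 ≤ lookahead P (fun s => x s ^ 2) s a := by
  have h := Finset.sum_sq_le_sum_mul_sum_of_sq_le_mul Finset.univ (r := fun s' => P s a s' * x s')
    (f := fun s' => P s a s') (g := fun s' => P s a s' * x s' ^ 2)
    (fun s' _ => (hP s a).1 s') (fun s' _ => mul_nonneg ((hP s a).1 s') (sq_nonneg _))
    (fun s' _ => le_of_eq (by ring))
  rw [(hP s a).2, one_mul] at h
  exact h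

/-- The advantages `q - x` of a Bellman equation have total second moment at most that of the
rewards, up to one factor of the horizon. -/
lemma sum_visitation_sq_advantage_le (hγ0 : 0 ≤ γ) (hγ1 : γ < 1)
    (hP : ∀ s a, P s a ∈ stdSimplex ℝ S)
    (hπ : π ∈ Policies S A) (hρ : ρ ∈ stdSimplex ℝ S) {f q : S → A → ℝ} {x : S → ℝ}
    (hq : ∀ s a, q s a = f s a + γ * lookahead P x s a) (hx : ∀ s, x s = actionMean π q s) :
    ∑ s, visitation γ P π ρ s * actionMean π (fun s a => (q s a - x s) ^ 2) s ≤
      (∑ s, visitation γ P π ρ s * actionMean π (fun s a => f s a ^ 2) s) / (1 - γ) := by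
  have hg : 0 < 1 - γ := by linarith
  have key : ∀ s, actionMean π (fun s a => (q s a - x s) ^ 2) s ≤
      actionMean π (fun s a => f s a ^ 2) s / (1 - γ) -
        ((fun s => x s ^ 2) s - γ * actionMean π (lookahead P (fun s => x s ^ 2)) s) := by
    intro s
    have h1 : actionMean π (fun s a => (q s a - x s) ^ 2) s =
        actionMean π (fun s a => q s a ^ 2) s - x s ^ 2 := by
      have h2 : (fun s a => (q s a - x s) ^ 2) =
          fun s a => (q s a ^ 2 + x s ^ 2) - 2 * (x s * q s a) := by
        funext s a; ring
      have h3 : actionMean π (fun s a => x s * q s a) s = x s * actionMean π q s := by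
        simp only [actionMean, Finset.mul_sum]
        exact Finset.sum_congr rfl fun a _ => by ring
      rw [h2, actionMean_sub, actionMean_add, actionMean_smul, actionMean_const hπ (fun s => x s ^ 2),
        h3, ← hx s]
      ring
    have h4 : actionMean π (fun s a => q s a ^ 2) s ≤
        actionMean π (fun s a => (1 / (1 - γ)) * f s a ^ 2 +
          γ * lookahead P (fun s => x s ^ 2) s a) s := by
      refine actionMean_mono hπ fun a => ?_
      have h5 := mul_le_mul_of_nonneg_left (sq_lookahead_le hP x s a) hγ0
      rw [hq]
      refine le_trans ?_ (add_le_add_right h5 _)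
      set z := lookahead P x s a
      set b := f s a
      -- Convexity of the square: b + γz is the average of b/(1-γ) and z with weights 1-γ and γ.
      have h6 : 1 / (1 - γ) * b ^ 2 + γ * z ^ 2 - (b + γ * z) ^ 2 =
          γ / (1 - γ) * (b - (1 - γ) * z) ^ 2 := by
        field_simp
        ring
      have h7 : 0 ≤ γ / (1 - γ) * (b - (1 - γ) * z) ^ 2 := by positivity
      linarith
    rw [actionMean_add, actionMean_smul, actionMean_smul] at h4
    rw [h1]
    have : 1 / (1 - γ) * actionMean π (fun s a => f s a ^ 2) s =
      actionMean π (fun s a => f s a ^ 2) s / (1 - γ) := by ring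
    simp only
    linarith
  have h8 := Finset.sum_le_sum fun s (_ : s ∈ Finset.univ) =>
    mul_le_mul_of_nonneg_left (key s) (visitation_nonneg hγ0 hP hπ hρ s)
  simp only [mul_sub (visitation γ P π ρ _) (_ / (1 - γ)), Finset.sum_sub_distrib] at h8
  -- The squares of x telescope by the flow equation; what remains is the mean of x² under ρ with a
  -- minus sign, which is dropped.
  rw [sum_visitation_mul_sub hγ0 hγ1 hP hπ hρ (fun s => x s ^ 2)] at h8
  have h9 : 0 ≤ ∑ s, ρ s * x s ^ 2 :=
    Finset.sum_nonneg fun s _ => mul_nonneg (hρ.1 s) (sq_nonneg _)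
  rw [Finset.sum_div]
  simp only [mul_div_assoc]
  linarith

lemma sq_sum_visitation_mul_le (hγ0 : 0 ≤ γ) (hP : ∀ s a, P s a ∈ stdSimplex ℝ S)
    (hπ : π ∈ Policies S A) (hρ : ρ ∈ stdSimplex ℝ S) (y z : S → A → ℝ) :
    (∑ s, visitation γ P π ρ s * actionMean π (fun s a => y s a * z s a) s) ^ 2 ≤
      (∑ s, visitation γ P π ρ s * actionMean π (fun s a => y s a ^ 2) s) *
      ∑ s, visitation γ P π ρ s * actionMean π (fun s a => z s a ^ 2) s := by
  have h := Finset.sum_sq_le_sum_mul_sum_of_sq_le_mul (Finset.univ : Finset (S × A))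
    (r := fun i => visitation γ P π ρ i.1 * (π i.1 i.2 * (y i.1 i.2 * z i.1 i.2)))
    (f := fun i => visitation γ P π ρ i.1 * (π i.1 i.2 * y i.1 i.2 ^ 2))
    (g := fun i => visitation γ P π ρ i.1 * (π i.1 i.2 * z i.1 i.2 ^ 2))
    (fun i _ => mul_nonneg (visitation_nonneg hγ0 hP hπ hρ _)
      (mul_nonneg ((hπ _).1 _) (sq_nonneg _)))
    (fun i _ => mul_nonneg (visitation_nonneg hγ0 hP hπ hρ _)
      (mul_nonneg ((hπ _).1 _) (sq_nonneg _)))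
    (fun i _ => le_of_eq (by ring))
  simp only [Fintype.sum_prod_type] at h
  simpa only [actionMean, Finset.mul_sum] using h

lemma sq_actionMean_mul_le (hπ : π ∈ Policies S A) (y z : S → A → ℝ) (s : S) :
    actionMean π (fun s a => y s a * z s a) s ^ 2 ≤
      actionMean π (fun s a => y s a ^ 2) s * actionMean π (fun s a => z s a ^ 2) s :=
  Finset.sum_sq_le_sum_mul_sum_of_sq_le_mul Finset.univ
    (fun a _ => mul_nonneg ((hπ s).1 a) (sq_nonneg _))
    (fun a _ => mul_nonneg ((hπ s).1 a) (sq_nonneg _)) (fun a _ => le_of_eq (by ring))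

end Discounted

/-! ### Entropy and exponential tilts on the simplex -/

section Simplex

variable {A : Type*} [Fintype A]

/-- Gibbs' inequality, from log z ≤ z - 1. Where p vanishes the term is zero whatever value the
logarithm takes. -/
lemma sum_mul_log_sub_log_le {p q : A → ℝ} (hp : p ∈ stdSimplex ℝ A) (hq : ∀ a, 0 < q a)
    (hq1 : ∑ a, q a = 1) : ∑ a, p a * (Real.log (q a) - Real.log (p a)) ≤ 0 := by
  calc ∑ a, p a * (Real.log (q a) - Real.log (p a)) ≤ ∑ a, (q a - p a) := by
        refine Finset.sum_le_sum fun a _ => ?_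
        rcases (hp.1 a).eq_or_lt with h | h
        · rw [← h]; simpa using (hq a).le
        · rw [← Real.log_div (hq a).ne' h.ne']
          have h1 := Real.log_le_sub_one_of_pos (div_pos (hq a) h)
          have h2 := mul_le_mul_of_nonneg_left h1 h.le
          have h3 : p a * (q a / p a - 1) = q a - p a := by field_simp
          linarith
    _ = 0 := by rw [Finset.sum_sub_distrib, hq1, hp.2, sub_self]

lemma sum_mul_log_nonpos {p : A → ℝ} (hp : p ∈ stdSimplex ℝ A) :
    ∑ a, p a * Real.log (p a) ≤ 0 :=
  Finset.sum_nonpos fun a _ => mul_nonpos_of_nonneg_of_nonpos (hp.1 a)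
    (Real.log_nonpos (hp.1 a) (by
      rw [← hp.2]; exact Finset.single_le_sum (fun i _ => hp.1 i) (Finset.mem_univ a)))

lemma neg_log_card_le_sum_mul_log [Nonempty A] {p : A → ℝ} (hp : p ∈ stdSimplex ℝ A) :
    -Real.log (Fintype.card A) ≤ ∑ a, p a * Real.log (p a) := by
  have hA : (0 : ℝ) < Fintype.card A := by exact_mod_cast Fintype.card_pos
  have h := sum_mul_log_sub_log_le (q := fun _ => (Fintype.card A : ℝ)⁻¹) hp
    (fun _ => inv_pos.2 hA) (by simp [hA.ne'])
  simp only [mul_sub, Finset.sum_sub_distrib, ← Finset.sum_mul, hp.2, Real.log_inv] at h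
  linarith

lemma abs_mul_log_le_one {x : ℝ} (h0 : 0 ≤ x) (h1 : x ≤ 1) : |x * Real.log x| ≤ 1 := by
  rcases h0.eq_or_lt with h | h
  · simp [← h]
  · rw [mul_comm]; exact (Real.abs_log_mul_self_lt x h h1).le

/-- Substituting √x, with log x = 2 log √x, turns this into the square of the bound for x log x. -/
lemma mul_sq_log_le_four {x : ℝ} (h0 : 0 ≤ x) (h1 : x ≤ 1) : x * Real.log x ^ 2 ≤ 4 := by
  have h := abs_mul_log_le_one (Real.sqrt_nonneg x) (Real.sqrt_le_one.2 h1)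
  have h2 : x * Real.log x ^ 2 = 4 * (√x * Real.log √x) ^ 2 := by
    rw [mul_pow, Real.sq_sqrt h0, Real.log_sqrt h0]; ring
  have h3 : (√x * Real.log √x) ^ 2 ≤ 1 := by rw [← sq_abs]; exact pow_le_one₀ (abs_nonneg _) h
  linarith

/-- Second-order estimates for an exponential tilt of a distribution. -/
lemma exponential_tilt_estimates [Nonempty A] {p p' h y : A → ℝ} {ψ τ : ℝ}
    (hp : p ∈ stdSimplex ℝ A) (hpos : ∀ a, 0 < p a) (hp' : p' ∈ stdSimplex ℝ A)
    (hy : ∀ a, y a = h a - ψ) (hpp : ∀ a, p' a = p a * Real.exp (y a))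
    (hh : ∀ a, |h a| ≤ τ) (hτ : τ ≤ 1 / 2) :
    (∀ a, |y a| ≤ 2 * τ) ∧ (∀ a, |Real.exp (y a) - 1| ≤ 4 * τ) ∧
    (∀ a, |Real.exp (y a) - 1 - (h a - ∑ b, p b * h b)| ≤ 8 * τ ^ 2) ∧
    |∑ a, p' a * y a| ≤ 12 * τ ^ 2 := by
  -- The normaliser lies in [-τ, τ]: otherwise all exponents y would have one strict sign and the
  -- total mass would move away from one.
  have hψ1 : ψ ≤ τ := by
    by_contra! hc
    have : ∑ a, p' a < ∑ a, p a := Finset.sum_lt_sum_of_nonempty Finset.univ_nonempty fun a _ => by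
      rw [hpp]
      refine mul_lt_of_lt_one_right (hpos a) (Real.exp_zero ▸ Real.exp_lt_exp.2 ?_)
      rw [hy]; linarith [(abs_le.1 (hh a)).2]
    rw [hp.2, hp'.2] at this
    exact lt_irrefl _ this
  have hψ2 : -τ ≤ ψ := by
    by_contra! hc
    have : ∑ a, p a < ∑ a, p' a := Finset.sum_lt_sum_of_nonempty Finset.univ_nonempty fun a _ => by
      rw [hpp]
      refine lt_mul_of_one_lt_right (hpos a) (Real.one_lt_exp_iff.2 ?_)
      rw [hy]; linarith [(abs_le.1 (hh a)).1]
    rw [hp.2, hp'.2] at this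
    exact lt_irrefl _ this
  have hτ0 : 0 ≤ τ := by linarith
  have h1 : ∀ a, |y a| ≤ 2 * τ := fun a => by
    have := abs_le.1 (hh a)
    rw [hy, abs_le]; constructor <;> linarith
  have h2 : ∀ a, |Real.exp (y a) - 1| ≤ 4 * τ := fun a => by
    have := Real.abs_exp_sub_one_le (x := y a) (by linarith [h1 a])
    linarith [h1 a]
  have hsq : ∀ a, y a ^ 2 ≤ 4 * τ ^ 2 := fun a => by
    have : |y a| ^ 2 ≤ (2 * τ) ^ 2 := pow_le_pow_left₀ (abs_nonneg _) (h1 a) 2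
    rw [sq_abs] at this; linarith
  have h3 : ∀ a, |Real.exp (y a) - 1 - y a| ≤ 4 * τ ^ 2 := fun a =>
    (Real.abs_exp_sub_one_sub_id_le (by linarith [h1 a])).trans (hsq a)
  have hmean : ∑ a, p a * y a = ∑ b, p b * h b - ψ := by
    simp only [hy, mul_sub, Finset.sum_sub_distrib, ← Finset.sum_mul, hp.2, one_mul]
  -- Mass conservation says that exp y - 1 has mean zero under p, so the mean of y is only a
  -- second-order quantity.
  have h4 : |∑ a, p a * y a| ≤ 4 * τ ^ 2 := by
    have e : ∑ a, p a * y a = -∑ a, p a * (Real.exp (y a) - 1 - y a) := by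
      have : ∑ a, p a * Real.exp (y a) = 1 := by rw [← hp'.2]; simp only [hpp]
      simp only [mul_sub, Finset.sum_sub_distrib, mul_one, this, hp.2]
      ring
    rw [e, abs_neg]
    refine (Finset.abs_sum_le_sum_abs _ _).trans ?_
    calc ∑ a, |p a * (Real.exp (y a) - 1 - y a)| ≤ ∑ a, p a * (4 * τ ^ 2) := by
          refine Finset.sum_le_sum fun a _ => ?_
          rw [abs_mul, abs_of_pos (hpos a)]
          exact mul_le_mul_of_nonneg_left (h3 a) (hpos a).le
      _ = 4 * τ ^ 2 := by rw [← Finset.sum_mul, hp.2, one_mul]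
  refine ⟨h1, h2, fun a => ?_, ?_⟩
  · have e : Real.exp (y a) - 1 - (h a - ∑ b, p b * h b) =
        (Real.exp (y a) - 1 - y a) + ∑ b, p b * y b := by rw [hmean, hy]; ring
    rw [e]
    exact (abs_add_le _ _).trans (by linarith [h3 a])
  · have e : ∑ a, p' a * y a = ∑ a, p a * y a + ∑ a, p a * ((Real.exp (y a) - 1) * y a) := by
      rw [← Finset.sum_add_distrib]
      exact Finset.sum_congr rfl fun a _ => by rw [hpp]; ring
    have h5 : |∑ a, p a * ((Real.exp (y a) - 1) * y a)| ≤ 8 * τ ^ 2 := by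
      refine (Finset.abs_sum_le_sum_abs _ _).trans ?_
      calc ∑ a, |p a * ((Real.exp (y a) - 1) * y a)| ≤ ∑ a, p a * (8 * τ ^ 2) := by
            refine Finset.sum_le_sum fun a _ => ?_
            rw [abs_mul, abs_of_pos (hpos a), abs_mul]
            refine mul_le_mul_of_nonneg_left ?_ (hpos a).le
            have := mul_le_mul (h2 a) (h1 a) (abs_nonneg _) (by linarith)
            linarith
        _ = 8 * τ ^ 2 := by rw [← Finset.sum_mul, hp.2, one_mul]
    rw [e]
    exact (abs_add_le _ _).trans (by linarith)

end Simplex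

/-! ### Perturbation of the logits of a softmax policy -/

section Softmax

variable {S A : Type*} [Fintype S] [Fintype A]

/-- The function `u` centred at its mean under `π(· | s)`. -/
def centered (π u : S → A → ℝ) (s : S) (a : A) : ℝ := u s a - actionMean π u s

lemma actionMean_centered {π : S → A → ℝ} (hπ : π ∈ Policies S A) (u : S → A → ℝ) (s : S) :
    actionMean π (centered π u) s = 0 := by
  have := actionMean_sub π u (fun s _ => actionMean π u s) s
  rw [actionMean_const hπ] at this
  exact this.trans (sub_self _)

lemma softmaxPolicy_pos [Nonempty A] (θ : EuclideanSpace ℝ (S × A)) (s : S) (a : A) :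
    0 < softmaxPolicy θ s a :=
  div_pos (Real.exp_pos _) (Finset.sum_pos (fun _ _ => Real.exp_pos _) Finset.univ_nonempty)

lemma softmaxPolicy_mem [Nonempty A] (θ : EuclideanSpace ℝ (S × A)) :
    softmaxPolicy θ ∈ Policies S A := by
  refine fun s => ⟨fun a => (softmaxPolicy_pos θ s a).le, ?_⟩
  simp only [softmaxPolicy, ← Finset.sum_div]
  exact div_self (Finset.sum_pos (fun _ _ => Real.exp_pos _) Finset.univ_nonempty).ne'

lemma policy_le_one {π : S → A → ℝ} (hπ : π ∈ Policies S A) (s : S) (a : A) : π s a ≤ 1 := by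
  rw [← (hπ s).2]
  exact Finset.single_le_sum (fun i _ => (hπ s).1 i) (Finset.mem_univ a)

/-- A change of logits multiplies each probability by exp y with y = h - ψ, where ψ is the log ratio
of the normalisers. All bounds are relative to π(a|s), so they stay uniform as probabilities tend to
zero. -/
lemma exists_softmaxPolicy_add [Nonempty A] (θ h : EuclideanSpace ℝ (S × A)) {τ : ℝ}
    (hh : ‖h‖ ≤ τ) (hτ : τ ≤ 1 / 2) :
    ∃ y : S → A → ℝ,
      (∀ s a, softmaxPolicy (θ + h) s a = softmaxPolicy θ s a * Real.exp (y s a)) ∧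
      (∀ s a, |y s a| ≤ 2 * τ) ∧ (∀ s a, |Real.exp (y s a) - 1| ≤ 4 * τ) ∧
      (∀ s a, |Real.exp (y s a) - 1 - centered (softmaxPolicy θ) (fun s a => h (s, a)) s a| ≤
        8 * τ ^ 2) ∧
      ∀ s, |actionMean (softmaxPolicy (θ + h)) y s| ≤ 12 * τ ^ 2 := by
  let Z : EuclideanSpace ℝ (S × A) → S → ℝ := fun θ s => ∑ a, Real.exp (θ (s, a))
  have hZ : ∀ θ s, 0 < Z θ s := fun θ s =>
    Finset.sum_pos (fun _ _ => Real.exp_pos _) Finset.univ_nonempty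
  let ψ : S → ℝ := fun s => Real.log (Z (θ + h) s / Z θ s)
  have hy : ∀ s a, softmaxPolicy (θ + h) s a =
      softmaxPolicy θ s a * Real.exp (h (s, a) - ψ s) := fun s a => by
    have h1 : softmaxPolicy (θ + h) s a = Real.exp (θ (s, a) + h (s, a)) / Z (θ + h) s := rfl
    have h2 : softmaxPolicy θ s a = Real.exp (θ (s, a)) / Z θ s := rfl
    have h3 := (hZ θ s).ne'
    have h4 := (hZ (θ + h) s).ne'
    rw [h1, h2, Real.exp_sub, Real.exp_log (div_pos (hZ _ s) (hZ _ s)), Real.exp_add]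
    field_simp
  have hb : ∀ s a, |h (s, a)| ≤ τ := fun s a => by
    have := PiLp.norm_apply_le h (s, a)
    rw [Real.norm_eq_abs] at this
    linarith
  have key := fun s => exponential_tilt_estimates (softmaxPolicy_mem θ s) (softmaxPolicy_pos θ s)
    (softmaxPolicy_mem (θ + h) s) (y := fun a => h (s, a) - ψ s) (fun a => rfl) (hy s) (hb s) hτ
  exact ⟨fun s a => h (s, a) - ψ s, hy, fun s => (key s).1, fun s => (key s).2.1,
    fun s => (key s).2.2.1, fun s => (key s).2.2.2⟩

end Softmax

/-! ### Smooth functions on the set of policies -/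

section PolicyFunctions

variable {S A : Type*} [Fintype S] [Fintype A]

lemma gradForm_apply (g v : S → A → ℝ) : gradForm g v = ∑ s, ∑ a, g s a * v s a := by
  simp [gradForm]

lemma abs_apply_le_norm (v : S → A → ℝ) (s : S) (a : A) : |v s a| ≤ ‖v‖ :=
  (norm_le_pi_norm (v s) a).trans (norm_le_pi_norm v s)

lemma norm_le_of_abs_le {v : S → A → ℝ} {c : ℝ} (hc : 0 ≤ c) (h : ∀ s a, |v s a| ≤ c) : ‖v‖ ≤ c :=
  (pi_norm_le_iff_of_nonneg hc).2 fun s => (pi_norm_le_iff_of_nonneg hc).2 fun a => h s a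

lemma abs_gradForm_le (g v : S → A → ℝ) : |gradForm g v| ≤ (∑ s, ∑ a, |g s a|) * ‖v‖ := by
  rw [gradForm_apply, Finset.sum_mul]
  refine (Finset.abs_sum_le_sum_abs _ _).trans (Finset.sum_le_sum fun s _ => ?_)
  rw [Finset.sum_mul]
  refine (Finset.abs_sum_le_sum_abs _ _).trans (Finset.sum_le_sum fun a _ => ?_)
  rw [abs_mul]
  exact mul_le_mul_of_nonneg_left (abs_apply_le_norm v s a) (abs_nonneg _)

lemma convex_policies : Convex ℝ (Policies S A) := by
  have : Policies S A = Set.univ.pi fun _ => stdSimplex ℝ A := by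
    ext π; simp [Policies, Set.mem_pi]
  rw [this]
  exact convex_pi fun _ _ => convex_stdSimplex ℝ A

/-- `q` is an `L`-Lipschitz function on the set of policies with `K`-Lipschitz gradient `G`. -/
structure IsSmoothPolicyFun (q : (S → A → ℝ) → ℝ) (G : (S → A → ℝ) → S → A → ℝ) (L K : ℝ) :
    Prop where
  grad : ∀ π ∈ Policies S A, HasPolicyGradientAt q (G π) π
  lipschitz : ∀ π ∈ Policies S A, ∀ π' ∈ Policies S A, |q π - q π'| ≤ L * ‖π - π'‖
  smooth : ∀ π ∈ Policies S A, ∀ π' ∈ Policies S A,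
    ∑ x, ∑ b, |G π x b - G π' x b| ≤ K * ‖π - π'‖

namespace IsSmoothPolicyFun

variable {q : (S → A → ℝ) → ℝ} {G : (S → A → ℝ) → S → A → ℝ} {L K : ℝ}

lemma abs_remainder_le (hq : IsSmoothPolicyFun q G L K) (hK : 0 ≤ K) {π π' : S → A → ℝ}
    (hπ : π ∈ Policies S A) (hπ' : π' ∈ Policies S A) :
    |q π' - q π - gradForm (G π) (π' - π)| ≤ K * ‖π' - π‖ ^ 2 := by
  have hseg : segment ℝ π π' ⊆ Policies S A := convex_policies.segment_subset hπ hπ'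
  have h := (convex_segment π π').norm_image_sub_le_of_norm_hasFDerivWithin_le' (f := q)
    (f' := fun x => gradForm (G x)) (φ := gradForm (G π)) (C := K * ‖π' - π‖)
    (fun x hx => (hq.grad x (hseg hx)).mono hseg) (fun x hx => ?_)
    (left_mem_segment ℝ π π') (right_mem_segment ℝ π π')
  · rw [Real.norm_eq_abs] at h
    calc _ ≤ K * ‖π' - π‖ * ‖π' - π‖ := h
      _ = _ := by ring
  · refine ContinuousLinearMap.opNorm_le_bound _ (by positivity) fun v => ?_
    have e : (gradForm (G x) - gradForm (G π)) v = gradForm (fun s a => G x s a - G π s a) v := by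
      simp [gradForm_apply, sub_mul, Finset.sum_sub_distrib]
    rw [e, Real.norm_eq_abs]
    refine (abs_gradForm_le _ _).trans (mul_le_mul_of_nonneg_right ?_ (norm_nonneg _))
    refine (hq.smooth x (hseg hx) π hπ).trans (mul_le_mul_of_nonneg_left ?_ hK)
    have := norm_sub_le_of_mem_segment hx
    exact this

/-- Difference quotients along the segment, with t → 0. Only feasible directions are controlled: a
derivative within the policies does not determine the gradient transversally to the simplices. -/
lemma abs_gradForm_sub_le (hq : IsSmoothPolicyFun q G L K) (hK : 0 ≤ K) {π π' : S → A → ℝ}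
    (hπ : π ∈ Policies S A) (hπ' : π' ∈ Policies S A) :
    |gradForm (G π) (π' - π)| ≤ L * ‖π' - π‖ := by
  set v := π' - π with hv
  have key : ∀ t : ℝ, 0 < t → t ≤ 1 → |gradForm (G π) v| ≤ L * ‖v‖ + t * (K * ‖v‖ ^ 2) := by
    intro t ht0 ht1
    have hm : π + t • v ∈ Policies S A := convex_policies.add_smul_sub_mem hπ hπ' ⟨ht0.le, ht1⟩
    have h1 := hq.abs_remainder_le hK hπ hm
    have h2 := hq.lipschitz _ hm _ hπ
    simp only [add_sub_cancel_left, map_smul, smul_eq_mul, norm_smul, Real.norm_eq_abs,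
      abs_of_pos ht0] at h1 h2
    have h3 : |t * gradForm (G π) v| ≤ L * (t * ‖v‖) + K * (t * ‖v‖) ^ 2 := by
      rw [abs_le] at h1 h2 ⊢
      constructor <;> linarith
    rw [abs_mul, abs_of_pos ht0] at h3
    refine le_of_mul_le_mul_left ?_ ht0
    calc _ ≤ _ := h3
      _ = _ := by ring
  refine le_of_forall_pos_le_add fun e he => ?_
  have hc : 0 ≤ K * ‖v‖ ^ 2 := by positivity
  have ht : 0 < min 1 (e / (K * ‖v‖ ^ 2 + 1)) := lt_min one_pos (by positivity)
  refine (key _ ht (min_le_left _ _)).trans ?_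
  have : min 1 (e / (K * ‖v‖ ^ 2 + 1)) * (K * ‖v‖ ^ 2) ≤ e := by
    calc _ ≤ e / (K * ‖v‖ ^ 2 + 1) * (K * ‖v‖ ^ 2 + 1) :=
          mul_le_mul (min_le_right _ _) (by linarith) hc (by positivity)
      _ = e := by field_simp
  linarith

/-- A direction π·y with y of mean zero is feasible after scaling, since π(1 + y/c) is a policy for
c > ‖y‖. The scale then cancels. -/
lemma abs_gradForm_mul_le (hq : IsSmoothPolicyFun q G L K) (hK : 0 ≤ K) {π y : S → A → ℝ}
    (hπ : π ∈ Policies S A) (hy : ∀ s, actionMean π y s = 0) :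
    |gradForm (G π) (fun s a => π s a * y s a)| ≤ L * ‖fun s a => π s a * y s a‖ := by
  set c := ‖y‖ + 1 with hc
  have hc0 : 0 < c := by positivity
  set v : S → A → ℝ := fun s a => π s a * y s a with hv
  have hm : π + c⁻¹ • v ∈ Policies S A := by
    refine fun s => ⟨fun a => ?_, ?_⟩
    · have h1 : -1 ≤ c⁻¹ * y s a := by
        have h2 := abs_apply_le_norm y s a
        have h3 : |c⁻¹ * y s a| ≤ 1 := by
          rw [abs_mul, abs_of_pos (inv_pos.2 hc0), inv_mul_le_iff₀ hc0]
          linarith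
        exact (abs_le.1 h3).1
      have h4 : (π + c⁻¹ • v) s a = π s a * (1 + c⁻¹ * y s a) := by
        simp only [Pi.add_apply, Pi.smul_apply, smul_eq_mul, hv]; ring
      rw [h4]
      exact mul_nonneg ((hπ s).1 a) (by linarith)
    · simp only [Pi.add_apply, Pi.smul_apply, smul_eq_mul, hv, Finset.sum_add_distrib, (hπ s).2,
        ← Finset.mul_sum]
      have := hy s
      rw [actionMean] at this
      rw [this]; simp
  have h := hq.abs_gradForm_sub_le hK hπ hm
  simp only [add_sub_cancel_left, map_smul, smul_eq_mul, norm_smul, Real.norm_eq_abs, abs_mul,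
    abs_of_pos (inv_pos.2 hc0)] at h
  rw [mul_left_comm] at h
  exact le_of_mul_le_mul_left h (inv_pos.2 hc0)

end IsSmoothPolicyFun

namespace PeMDP

/-- The action value `r_π(s, a) + γ ∑_{s'} P_π(s' | s, a) v(s')` for the continuation values `v`. -/
def actionValue (M : PeMDP S A) (v : S → ℝ) (π : S → A → ℝ) (s : S) (a : A) : ℝ :=
  M.reward π s a + M.discount * lookahead (M.trans π) v s a

/-- The gradient of `actionValue` in terms of the gradients `Gr` of the reward and `GP` of the
transition kernel. -/
def actionValueGradient (M : PeMDP S A) (Gr : (S → A → ℝ) → S → A → (S → A → ℝ))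
    (GP : (S → A → ℝ) → S → A → S → (S → A → ℝ)) (v : S → ℝ) (π : S → A → ℝ) (s : S) (a : A) :
    S → A → ℝ :=
  fun x b => Gr π s a x b + M.discount * ∑ s', v s' * GP π s a s' x b

/-- The continuation values v are frozen, so only the one-step dependence on the policy enters; the
long-run dependence is handled through visitation measures. -/
lemma isSmoothPolicyFun_actionValue {M : PeMDP S A} {Rmax Lr Lp R2 T2 : ℝ}
    (hM : M.IsSmooth Rmax Lr Lp R2 T2) {Gr : (S → A → ℝ) → S → A → (S → A → ℝ)}
    {GP : (S → A → ℝ) → S → A → S → (S → A → ℝ)}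
    (hGr : ∀ π ∈ Policies S A, ∀ s a, HasPolicyGradientAt (fun π => M.reward π s a) (Gr π s a) π)
    (hGr' : ∀ π ∈ Policies S A, ∀ π' ∈ Policies S A,
      ∑ s, ∑ a, ∑ x, ∑ b, |Gr π s a x b - Gr π' s a x b| ≤ R2 * ‖π - π'‖)
    (hGP : ∀ π ∈ Policies S A, ∀ s a s',
      HasPolicyGradientAt (fun π => M.trans π s a s') (GP π s a s') π)
    (hGP' : ∀ π ∈ Policies S A, ∀ π' ∈ Policies S A, ∀ s a,
      ∑ s', ∑ x, ∑ b, |GP π s a s' x b - GP π' s a s' x b| ≤ T2 * ‖π - π'‖)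
    {v : S → ℝ} {c : ℝ} (hc : 0 ≤ c) (hv : ∀ s, |v s| ≤ c) (s : S) (a : A) :
    IsSmoothPolicyFun (fun π => M.actionValue v π s a)
      (fun π => M.actionValueGradient Gr GP v π s a)
      (Lr + M.discount * Lp * c) (R2 + M.discount * T2 * c) where
  grad π hπ := by
    have h := (hGr π hπ s a).add ((HasFDerivWithinAt.fun_sum (u := Finset.univ) fun s' _ =>
      (hGP π hπ s a s').mul_const (v s')).const_mul M.discount)
    refine h.congr_fderiv ?_
    ext w
    simp only [add_apply, smul_apply, sum_apply, gradForm_apply, smul_eq_mul, actionValueGradient,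
      add_mul, Finset.sum_add_distrib, Finset.mul_sum, Finset.sum_mul]
    congr 1
    rw [Finset.sum_comm]
    refine Finset.sum_congr rfl fun x _ => ?_
    rw [Finset.sum_comm]
    exact Finset.sum_congr rfl fun b _ => Finset.sum_congr rfl fun s' _ => by ring
  lipschitz π hπ π' hπ' := by
    have h1 : |M.reward π s a - M.reward π' s a| ≤ Lr * ‖π - π'‖ := by
      refine le_trans ?_ (hM.reward_lipschitz π hπ π' hπ')
      refine le_trans ?_ (Finset.single_le_sum (f := fun s => ∑ a, |M.reward π s a - M.reward π' s a|)
        (fun s _ => Finset.sum_nonneg fun a _ => abs_nonneg _) (Finset.mem_univ s))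
      exact Finset.single_le_sum (f := fun a => |M.reward π s a - M.reward π' s a|)
        (fun a _ => abs_nonneg _) (Finset.mem_univ a)
    have h2 := abs_lookahead_le (P := fun s a s' => M.trans π s a s' - M.trans π' s a s')
      (hM.trans_lipschitz π hπ π' hπ' s a) hc hv
    have h3 : M.actionValue v π s a - M.actionValue v π' s a =
        (M.reward π s a - M.reward π' s a) + M.discount *
          lookahead (fun s a s' => M.trans π s a s' - M.trans π' s a s') v s a := by
      simp only [actionValue, lookahead, sub_mul, Finset.sum_sub_distrib]; ring
    rw [h3]
    refine (abs_add_le _ _).trans ?_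
    rw [abs_mul, abs_of_pos M.discount_pos]
    have := mul_le_mul_of_nonneg_left h2 M.discount_pos.le
    calc _ ≤ Lr * ‖π - π'‖ + M.discount * (Lp * ‖π - π'‖ * c) := add_le_add h1 this
      _ = _ := by ring
  smooth π hπ π' hπ' := by
    have h1 : ∑ x, ∑ b, |Gr π s a x b - Gr π' s a x b| ≤ R2 * ‖π - π'‖ := by
      refine le_trans ?_ (hGr' π hπ π' hπ')
      refine le_trans ?_ (Finset.single_le_sum
        (f := fun s => ∑ a, ∑ x, ∑ b, |Gr π s a x b - Gr π' s a x b|)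
        (fun s _ => Finset.sum_nonneg fun a _ => Finset.sum_nonneg fun _ _ =>
          Finset.sum_nonneg fun _ _ => abs_nonneg _) (Finset.mem_univ s))
      exact Finset.single_le_sum (f := fun a => ∑ x, ∑ b, |Gr π s a x b - Gr π' s a x b|)
        (fun a _ => Finset.sum_nonneg fun _ _ => Finset.sum_nonneg fun _ _ => abs_nonneg _)
        (Finset.mem_univ a)
    have h2 := hGP' π hπ π' hπ' s a
    have h3 : ∀ x b, |M.actionValueGradient Gr GP v π s a x b -
        M.actionValueGradient Gr GP v π' s a x b| ≤ |Gr π s a x b - Gr π' s a x b| +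
          M.discount * c * ∑ s', |GP π s a s' x b - GP π' s a s' x b| := fun x b => by
      have e : M.actionValueGradient Gr GP v π s a x b -
          M.actionValueGradient Gr GP v π' s a x b = (Gr π s a x b - Gr π' s a x b) +
          M.discount * ∑ s', v s' * (GP π s a s' x b - GP π' s a s' x b) := by
        simp only [actionValueGradient, mul_sub, Finset.sum_sub_distrib]; ring
      rw [e]
      refine (abs_add_le _ _).trans (add_le_add_right ?_ _)
      rw [abs_mul, abs_of_pos M.discount_pos, mul_assoc]
      refine mul_le_mul_of_nonneg_left ?_ M.discount_pos.le
      rw [Finset.mul_sum]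
      refine (Finset.abs_sum_le_sum_abs _ _).trans (Finset.sum_le_sum fun s' _ => ?_)
      rw [abs_mul]
      exact mul_le_mul_of_nonneg_right (hv s') (abs_nonneg _)
    refine (Finset.sum_le_sum fun x _ => Finset.sum_le_sum fun b _ => h3 x b).trans ?_
    simp only [Finset.sum_add_distrib, ← Finset.mul_sum]
    have h4 : ∑ x, ∑ b, ∑ s', |GP π s a s' x b - GP π' s a s' x b| =
        ∑ s', ∑ x, ∑ b, |GP π s a s' x b - GP π' s a s' x b| := by
      rw [Finset.sum_comm]
      conv_rhs => rw [Finset.sum_comm]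
      rw [Finset.sum_comm]
      exact Finset.sum_congr rfl fun x _ => Finset.sum_comm
    rw [h4]
    have := mul_le_mul_of_nonneg_left h2 (mul_nonneg M.discount_pos.le hc)
    calc _ ≤ R2 * ‖π - π'‖ + M.discount * c * (T2 * ‖π - π'‖) := add_le_add h1 this
      _ = _ := by ring

end PeMDP

end PolicyFunctions

/-! ### Removal of the cubic remainder, and gradient ascent -/

section Ascent

/-- With h = 2d, the remainder at h is a sum of four remainders at ±d: two for the two half steps
and two for the change of D in between. Quadratic bounds are reproduced exactly (4 · 1/4), while
cubic ones are halved (4 · 1/8). Iterating kills the cubic term and also removes the restriction to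
small h. -/
lemma abs_remainder_le_of_local {E : Type*} [NormedAddCommGroup E] [NormedSpace ℝ E] {f : E → ℝ}
    {D : E → E →L[ℝ] ℝ} {b k : ℝ}
    (H : ∀ θ h, ‖h‖ ≤ 1 / 2 → |f (θ + h) - f θ - D θ h| ≤ b * ‖h‖ ^ 2 + k * ‖h‖ ^ 3) (θ h : E) :
    |f (θ + h) - f θ - D θ h| ≤ b * ‖h‖ ^ 2 := by
  have key : ∀ n : ℕ, ∀ θ h : E, ‖h‖ ≤ 2 ^ n * (1 / 2) →
      |f (θ + h) - f θ - D θ h| ≤ b * ‖h‖ ^ 2 + k * ‖h‖ ^ 3 * (1 / 2) ^ n := by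
    intro n
    induction n with
    | zero => intro θ h hh; simpa using H θ h (by simpa using hh)
    | succ n ih =>
      intro θ h hh
      set d : E := (1 / 2 : ℝ) • h with hd
      have hdn : ‖d‖ = 1 / 2 * ‖h‖ := by rw [hd, norm_smul]; norm_num
      have hle : ‖d‖ ≤ 2 ^ n * (1 / 2) := by rw [hdn]; rw [pow_succ] at hh; linarith
      have hh2 : h = d + d := by rw [hd, ← add_smul]; norm_num
      have h1 := ih θ d hle
      have h2 := ih (θ + d) d hle
      -- The backward step from θ + d to θ, combined with the forward one, bounds D (θ + d) d - D θ
      -- d without any regularity of D.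
      have h3 := ih (θ + d) (-d) (by rwa [norm_neg])
      rw [norm_neg, add_neg_cancel_right, map_neg] at h3
      have h4 : f (θ + h) - f θ - D θ h = f (θ + d + d) - f θ - (D θ d + D θ d) := by
        rw [hh2, map_add, add_assoc]
      have h5 : b * ‖h‖ ^ 2 + k * ‖h‖ ^ 3 * (1 / 2) ^ (n + 1) =
          4 * (b * ‖d‖ ^ 2 + k * ‖d‖ ^ 3 * (1 / 2) ^ n) := by rw [hdn]; ring
      rw [h4, h5]
      rw [abs_le] at h1 h2 h3 ⊢
      constructor <;> linarith
  have hlim : Filter.Tendsto (fun n : ℕ => b * ‖h‖ ^ 2 + k * ‖h‖ ^ 3 * (1 / 2 : ℝ) ^ n)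
      Filter.atTop (nhds (b * ‖h‖ ^ 2 + k * ‖h‖ ^ 3 * 0)) :=
    ((tendsto_pow_atTop_nhds_zero_of_lt_one (by norm_num) (by norm_num)).const_mul _).const_add _
  rw [mul_zero, add_zero] at hlim
  refine ge_of_tendsto hlim ?_
  have hev : ∀ᶠ n : ℕ in Filter.atTop, 2 * ‖h‖ ≤ (2 : ℝ) ^ n :=
    (tendsto_pow_atTop_atTop_of_one_lt (by norm_num : (1 : ℝ) < 2)).eventually_ge_atTop _
  filter_upwards [hev] with n hn
  exact key n θ h (by linarith)

variable {E : Type*} [NormedAddCommGroup E] [InnerProductSpace ℝ E] [CompleteSpace E] {f : E → ℝ}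

lemma inner_gradient_eq {D : E → E →L[ℝ] ℝ} {b : ℝ}
    (H : ∀ θ h, |f (θ + h) - f θ - D θ h| ≤ b * ‖h‖ ^ 2) (θ h : E) :
    inner ℝ (gradient f θ) h = D θ h := by
  have hd : HasFDerivAt f (D θ) θ := by
    rw [hasFDerivAt_iff_isLittleO_nhds_zero]
    refine Asymptotics.IsBigO.trans_isLittleO ?_
      (Asymptotics.isLittleO_norm_pow_id one_lt_two)
    refine Asymptotics.IsBigO.of_bound b (Filter.Eventually.of_forall fun h => ?_)
    rw [Real.norm_eq_abs, norm_pow, norm_norm]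
    exact H θ h
  rw [hd.hasGradientAt.gradient, InnerProductSpace.toDual_symm_apply]

/-- Each step gains at least η/2 ‖∇f‖², because ηb ≤ 1/2 lets the remainder consume at most half of
the linear gain. The gains telescope, and some iterate is no worse than the average. -/
lemma exists_norm_gradient_le {D : E → E →L[ℝ] ℝ} {b η F : ℝ} (hη : 0 ≤ η) (hηb : η * b ≤ 1 / 2)
    (H : ∀ θ h, |f (θ + h) - f θ - D θ h| ≤ b * ‖h‖ ^ 2) {x : ℕ → E}
    (hx : ∀ t, x (t + 1) = x t + η • gradient f (x t)) (hF : ∀ θ, f θ ≤ F) {T : ℕ} (hT : 1 ≤ T) :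
    ∃ t < T, T * (η / 2 * ‖gradient f (x t)‖ ^ 2) ≤ F - f (x 0) := by
  have step : ∀ t, η / 2 * ‖gradient f (x t)‖ ^ 2 ≤ f (x (t + 1)) - f (x t) := by
    intro t
    set g := gradient f (x t) with hg
    have h1 := (abs_le.1 (H (x t) (η • g))).1
    rw [← inner_gradient_eq H, ← hg, inner_smul_right, real_inner_self_eq_norm_sq, norm_smul,
      Real.norm_eq_abs, abs_of_nonneg hη] at h1
    rw [hx t]
    have h2 : η * b * (η * ‖g‖ ^ 2) ≤ 1 / 2 * (η * ‖g‖ ^ 2) :=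
      mul_le_mul_of_nonneg_right hηb (by positivity)
    nlinarith
  have hsum : ∑ t ∈ Finset.range T, η / 2 * ‖gradient f (x t)‖ ^ 2 ≤
      ∑ t ∈ Finset.range T, (F - f (x 0)) / T := by
    refine (Finset.sum_le_sum fun t _ => step t).trans ?_
    rw [Finset.sum_range_sub (fun t => f (x t)), Finset.sum_const, Finset.card_range, nsmul_eq_mul]
    have : (0 : ℝ) < T := by exact_mod_cast hT
    rw [mul_div_cancel₀ _ this.ne']
    linarith [hF (x T)]
  obtain ⟨t, ht, hle⟩ := Finset.exists_le_of_sum_le (Finset.nonempty_range_iff.2 (by omega)) hsum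
  have hT0 : (0 : ℝ) < T := by exact_mod_cast hT
  refine ⟨t, Finset.mem_range.1 ht, ?_⟩
  rw [le_div_iff₀ hT0] at hle
  linarith

end Ascent

/-! ### First variation of the Bellman backup -/

section FirstVariation

variable {S A : Type*} [Fintype S] [Fintype A]

namespace PeMDP

/-- `Gr` and `GP` are gradients of the reward and of the transition kernel, with Lipschitz constants
`R2` and `T2`. -/
structure HasLipschitzGradients (M : PeMDP S A) (Gr : (S → A → ℝ) → S → A → (S → A → ℝ))
    (GP : (S → A → ℝ) → S → A → S → (S → A → ℝ)) (R2 T2 : ℝ) : Prop where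
  reward : ∀ π ∈ Policies S A, ∀ s a, HasPolicyGradientAt (fun π => M.reward π s a) (Gr π s a) π
  reward_lipschitz : ∀ π ∈ Policies S A, ∀ π' ∈ Policies S A,
    ∑ s, ∑ a, ∑ x, ∑ b, |Gr π s a x b - Gr π' s a x b| ≤ R2 * ‖π - π'‖
  trans : ∀ π ∈ Policies S A, ∀ s a s',
    HasPolicyGradientAt (fun π => M.trans π s a s') (GP π s a s') π
  trans_lipschitz : ∀ π ∈ Policies S A, ∀ π' ∈ Policies S A, ∀ s a,
    ∑ s', ∑ x, ∑ b, |GP π s a s' x b - GP π' s a s' x b| ≤ T2 * ‖π - π'‖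

/-- The soft reward `r_π(s, a) - lam * log π(a | s)`. -/
noncomputable def softReward (M : PeMDP S A) (lam : ℝ) (π : S → A → ℝ) (s : S) (a : A) : ℝ :=
  M.reward π s a - lam * Real.log (π s a)

open Classical in
/-- The soft value as a function of the initial state. -/
noncomputable def stateValue (M : PeMDP S A) (lam : ℝ) (π : S → A → ℝ) : S → ℝ :=
  returnFrom M.discount (M.trans π) π (M.softReward lam π)

/-- The soft action value for the continuation values `v`. -/
noncomputable def softActionValue (M : PeMDP S A) (lam : ℝ) (v : S → ℝ) (π : S → A → ℝ) (s : S)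
    (a : A) : ℝ :=
  M.actionValue v π s a - lam * Real.log (π s a)

/-- The derivative of the Bellman backup of `v` at the policy `π`, when the logits of the policy
move in the direction `u`. -/
noncomputable def firstVariation (M : PeMDP S A) (lam : ℝ)
    (Gr : (S → A → ℝ) → S → A → (S → A → ℝ))
    (GP : (S → A → ℝ) → S → A → S → (S → A → ℝ)) (v : S → ℝ) (π u : S → A → ℝ) (s : S) : ℝ :=
  actionMean π (fun s a => centered π u s a * M.softActionValue lam v π s a) s +
    actionMean π (fun s a => gradForm (M.actionValueGradient Gr GP v π s a)
      (fun s a => π s a * centered π u s a)) s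

lemma softActionValue_eq (M : PeMDP S A) (lam : ℝ) (v : S → ℝ) (π : S → A → ℝ) (s : S) (a : A) :
    M.softActionValue lam v π s a =
      M.softReward lam π s a + M.discount * lookahead (M.trans π) v s a := by
  simp only [softActionValue, actionValue, softReward]; ring

lemma stateValue_eq [Nonempty S] (M : PeMDP S A) (lam : ℝ) {π : S → A → ℝ}
    (hπ : π ∈ Policies S A) (s : S) :
    M.stateValue lam π s = actionMean π (M.softActionValue lam (M.stateValue lam π) π) s := by
  classical
  have h := returnFrom_eq M.discount_pos.le M.discount_lt_one (M.trans_mem π hπ) hπ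
    (M.softReward lam π) s
  have e : M.softActionValue lam (M.stateValue lam π) π = fun s a =>
      M.softReward lam π s a + M.discount * lookahead (M.trans π) (M.stateValue lam π) s a := by
    funext s a; exact M.softActionValue_eq ..
  rw [e]
  convert h using 2 <;> simp only [stateValue]

lemma softValue_eq [Nonempty S] (M : PeMDP S A) (lam : ℝ) {ρ : S → ℝ} (hρ : ρ ∈ stdSimplex ℝ S)
    {π : S → A → ℝ} (hπ : π ∈ Policies S A) :
    M.softValue lam ρ π = ∑ s, ρ s * M.stateValue lam π s := by
  classical
  refine (discountedReturn_eq_sum_returnFrom M.discount_pos.le M.discount_lt_one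
    (M.trans_mem π hπ) hπ hρ (M.softReward lam π)).trans ?_
  simp only [stateValue]

section Bounds

variable {M : PeMDP S A} {Rmax Lr Lp R2 T2 lam : ℝ}

/-- The soft reward is unbounded as probabilities tend to zero, but its mean is not: its entropy
part lies between 0 and λ log |A|. -/
lemma abs_actionMean_softReward_le [Nonempty A] (hM : M.IsSmooth Rmax Lr Lp R2 T2)
    (hlam : 0 ≤ lam) {π : S → A → ℝ} (hπ : π ∈ Policies S A) (s : S) :
    |actionMean π (M.softReward lam π) s| ≤ Rmax + lam * Real.log (Fintype.card A) := by
  have h1 : actionMean π (M.softReward lam π) s =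
      actionMean π (M.reward π) s - lam * actionMean π (fun s a => Real.log (π s a)) s := by
    rw [← actionMean_smul, ← actionMean_sub]; rfl
  have h2 := abs_actionMean_le hπ (s := s) fun a => hM.reward_bounded π hπ s a
  have h3 := mul_le_mul_of_nonneg_left (sum_mul_log_nonpos (hπ s)) hlam
  have h4 := mul_le_mul_of_nonneg_left (neg_log_card_le_sum_mul_log (hπ s)) hlam
  have h5 : actionMean π (fun s a => Real.log (π s a)) s = ∑ a, π s a * Real.log (π s a) := rfl
  have h6 : 0 ≤ lam * Real.log (Fintype.card A) :=
    mul_nonneg hlam (Real.log_nonneg (by exact_mod_cast Fintype.card_pos))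
  rw [h1, h5]
  rw [abs_le] at h2 ⊢
  constructor <;> linarith

lemma abs_stateValue_le [Nonempty S] [Nonempty A] (hM : M.IsSmooth Rmax Lr Lp R2 T2)
    (hlam : 0 ≤ lam) {π : S → A → ℝ} (hπ : π ∈ Policies S A) (s : S) :
    |M.stateValue lam π s| ≤ (Rmax + lam * Real.log (Fintype.card A)) / (1 - M.discount) := by
  classical
  exact abs_returnFrom_le M.discount_pos.le M.discount_lt_one (M.trans_mem π hπ) hπ
    (abs_actionMean_softReward_le hM hlam hπ) s

/-- The factor |A| arises from bounding π log² π by 4 separately for each action. -/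
lemma actionMean_sq_softReward_le [Nonempty A] (hM : M.IsSmooth Rmax Lr Lp R2 T2)
    {π : S → A → ℝ} (hπ : π ∈ Policies S A) (s : S) :
    actionMean π (fun s a => M.softReward lam π s a ^ 2) s ≤
      2 * Rmax ^ 2 + 8 * lam ^ 2 * Fintype.card A := by
  have h1 : ∀ a, π s a * M.softReward lam π s a ^ 2 ≤
      π s a * (2 * Rmax ^ 2) + 8 * lam ^ 2 := fun a => by
    have h2 : M.reward π s a ^ 2 ≤ Rmax ^ 2 := by
      rw [← sq_abs]
      exact pow_le_pow_left₀ (abs_nonneg _) (hM.reward_bounded π hπ s a) 2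
    have h3 := mul_sq_log_le_four ((hπ s).1 a) (policy_le_one hπ s a)
    have h4 : M.softReward lam π s a ^ 2 ≤
        2 * Rmax ^ 2 + 2 * (lam ^ 2 * Real.log (π s a) ^ 2) := by
      rw [softReward]
      nlinarith [sq_nonneg (M.reward π s a + lam * Real.log (π s a))]
    have h5 := mul_le_mul_of_nonneg_left h4 ((hπ s).1 a)
    have h6 := mul_le_mul_of_nonneg_left h3 (sq_nonneg lam)
    linarith
  refine (Finset.sum_le_sum fun a _ => h1 a).trans ?_
  rw [Finset.sum_add_distrib, ← Finset.sum_mul, (hπ s).2, Finset.sum_const, Finset.card_univ,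
    nsmul_eq_mul]
  linarith

lemma abs_actionValue_le (hM : M.IsSmooth Rmax Lr Lp R2 T2) {π : S → A → ℝ}
    (hπ : π ∈ Policies S A) {v : S → ℝ} {c : ℝ} (hc : 0 ≤ c) (hv : ∀ s, |v s| ≤ c) (s : S) (a : A) :
    |M.actionValue v π s a| ≤ Rmax + M.discount * c := by
  have h := abs_lookahead_le (P := M.trans π) (s := s) (a := a)
    (sum_abs_of_mem_stdSimplex (M.trans_mem π hπ s a)).le hc hv
  refine (abs_add_le _ _).trans (add_le_add (hM.reward_bounded π hπ s a) ?_)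
  rw [abs_mul, abs_of_pos M.discount_pos]
  rw [one_mul] at h
  exact mul_le_mul_of_nonneg_left h M.discount_pos.le

end Bounds

end PeMDP

lemma abs_centered_le {π : S → A → ℝ} (hπ : π ∈ Policies S A) {u : S → A → ℝ} {τ : ℝ}
    (hu : ∀ s a, |u s a| ≤ τ) (s : S) (a : A) : |centered π u s a| ≤ 2 * τ := by
  have h1 := abs_actionMean_le hπ (s := s) fun a => hu s a
  refine (abs_sub _ _).trans ?_
  linarith [hu s a]

lemma abs_actionMean_mul_le {π : S → A → ℝ} {y z : S → A → ℝ} {s : S}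
    {c d : ℝ} (hc : 0 ≤ c) (hy : ∀ a, |y s a| ≤ c) (hz : ∑ a, |π s a * z s a| ≤ d) :
    |actionMean π (fun s a => y s a * z s a) s| ≤ c * d := by
  refine (Finset.abs_sum_le_sum_abs _ _).trans ?_
  calc ∑ a, |π s a * (y s a * z s a)| ≤ ∑ a, c * |π s a * z s a| := by
        refine Finset.sum_le_sum fun a _ => ?_
        rw [mul_left_comm, abs_mul]
        exact mul_le_mul_of_nonneg_right (hy a) (abs_nonneg _)
    _ = c * ∑ a, |π s a * z s a| := by rw [Finset.mul_sum]
    _ ≤ c * d := mul_le_mul_of_nonneg_left hz hc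

lemma sum_abs_mul_softActionValue_le {M : PeMDP S A} {lam : ℝ} (hlam : 0 ≤ lam) {π : S → A → ℝ}
    (hπ : π ∈ Policies S A) {v : S → ℝ} {Q : ℝ} {s : S}
    (hQ : ∀ a, |M.actionValue v π s a| ≤ Q) :
    ∑ a, |π s a * M.softActionValue lam v π s a| ≤ Q + lam * Fintype.card A := by
  calc ∑ a, |π s a * M.softActionValue lam v π s a| ≤ ∑ a, (π s a * Q + lam) := by
        refine Finset.sum_le_sum fun a _ => ?_
        have h1 : π s a * M.softActionValue lam v π s a = π s a * M.actionValue v π s a -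
            lam * (π s a * Real.log (π s a)) := by rw [PeMDP.softActionValue]; ring
        rw [h1]
        refine (abs_sub _ _).trans (add_le_add ?_ ?_)
        · rw [abs_mul, abs_of_nonneg ((hπ s).1 a)]
          exact mul_le_mul_of_nonneg_left (hQ a) ((hπ s).1 a)
        · rw [abs_mul, abs_of_nonneg hlam]
          exact mul_le_of_le_one_right hlam
            (abs_mul_log_le_one ((hπ s).1 a) (policy_le_one hπ s a))
    _ = Q + lam * Fintype.card A := by
        rw [Finset.sum_add_distrib, ← Finset.sum_mul, (hπ s).2, Finset.sum_const, Finset.card_univ,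
          nsmul_eq_mul]
        ring

section Estimates

variable {M : PeMDP S A} {lam L K Q τ : ℝ} {Gr : (S → A → ℝ) → S → A → (S → A → ℝ)}
  {GP : (S → A → ℝ) → S → A → S → (S → A → ℝ)} {v : S → ℝ} {π : S → A → ℝ}

lemma abs_gradForm_centered_le (hπ : π ∈ Policies S A) (hL : 0 ≤ L) (hK : 0 ≤ K)
    (hq : ∀ s a, IsSmoothPolicyFun (fun π => M.actionValue v π s a)
      (fun π => M.actionValueGradient Gr GP v π s a) L K)
    {u : S → A → ℝ} (hτ : 0 ≤ τ) (hu : ∀ s a, |centered π u s a| ≤ τ) (s : S) (a : A) :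
    |gradForm (M.actionValueGradient Gr GP v π s a) (fun s a => π s a * centered π u s a)| ≤
      L * τ := by
  refine ((hq s a).abs_gradForm_mul_le hK hπ (actionMean_centered hπ u)).trans
    (mul_le_mul_of_nonneg_left ?_ hL)
  refine norm_le_of_abs_le hτ fun s a => ?_
  rw [abs_mul, abs_of_nonneg ((hπ s).1 a)]
  exact (mul_le_of_le_one_left (abs_nonneg _) (policy_le_one hπ s a)).trans (hu s a)

lemma abs_firstVariation_le (hπ : π ∈ Policies S A) (hlam : 0 ≤ lam) (hL : 0 ≤ L) (hK : 0 ≤ K)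
    (hq : ∀ s a, IsSmoothPolicyFun (fun π => M.actionValue v π s a)
      (fun π => M.actionValueGradient Gr GP v π s a) L K)
    (hQ : ∀ s a, |M.actionValue v π s a| ≤ Q)
    {u : S → A → ℝ} (hτ : 0 ≤ τ) (hu : ∀ s a, |u s a| ≤ τ) (s : S) :
    |M.firstVariation lam Gr GP v π u s| ≤ 2 * τ * (Q + lam * Fintype.card A + L) := by
  have hc := abs_centered_le hπ hu
  have h1 := abs_actionMean_mul_le (s := s) (by linarith) (hc s)
    (sum_abs_mul_softActionValue_le hlam hπ (hQ s))
  have h2 := abs_actionMean_le hπ (s := s)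
    (y := fun s a => gradForm (M.actionValueGradient Gr GP v π s a)
      (fun s a => π s a * centered π u s a))
    (abs_gradForm_centered_le hπ hL hK hq (by linarith) hc s)
  refine (abs_add_le _ _).trans ((add_le_add h1 h2).trans (le_of_eq ?_))
  ring

/-- Second-order estimate for the Bellman backup of `v` under a change of the logits. -/
lemma abs_backup_remainder_le [Nonempty A] (hlam : 0 ≤ lam) (hL : 0 ≤ L) (hK : 0 ≤ K)
    (hq : ∀ s a, IsSmoothPolicyFun (fun π => M.actionValue v π s a)
      (fun π => M.actionValueGradient Gr GP v π s a) L K)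
    (θ h : EuclideanSpace ℝ (S × A)) (hh : ‖h‖ ≤ τ) (hτ : τ ≤ 1 / 2)
    (hQ : ∀ s a, |M.actionValue v (softmaxPolicy θ) s a| ≤ Q) (s : S) :
    |actionMean (softmaxPolicy (θ + h)) (M.softActionValue lam v (softmaxPolicy (θ + h))) s -
        actionMean (softmaxPolicy θ) (M.softActionValue lam v (softmaxPolicy θ)) s -
        M.firstVariation lam Gr GP v (softmaxPolicy θ) (fun s a => h (s, a)) s| ≤
      (8 * (Q + lam * Fintype.card A) + 12 * lam + 16 * K + 24 * L) * τ ^ 2 := by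
  obtain ⟨y, hy, -, hy1, hy2, hy3⟩ := exists_softmaxPolicy_add θ h hh hτ
  have hτ0 : 0 ≤ τ := (norm_nonneg _).trans hh
  have hπ := softmaxPolicy_mem θ
  have hπ' := softmaxPolicy_mem (θ + h)
  have hpos := softmaxPolicy_pos θ
  set π := softmaxPolicy θ
  set π' := softmaxPolicy (θ + h)
  set u : S → A → ℝ := fun s a => h (s, a)
  set δ : S → A → ℝ := fun s a => Real.exp (y s a) - 1 with hδ
  have hd : ∀ s a, π' s a - π s a = π s a * δ s a := fun s a => by
    simp only [hδ]; rw [hy]; ring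
  have hδ0 : ∀ s, actionMean π δ s = 0 := fun s => by
    simp only [actionMean, ← hd, Finset.sum_sub_distrib, (hπ s).2, (hπ' s).2, sub_self]
  have hnorm : ‖π' - π‖ ≤ 4 * τ := norm_le_of_abs_le (by linarith) fun s a => by
    rw [Pi.sub_apply, Pi.sub_apply, hd, abs_mul, abs_of_pos (hpos s a)]
    exact (mul_le_of_le_one_left (abs_nonneg _) (policy_le_one hπ s a)).trans (hy1 s a)
  have hlog : ∀ a, Real.log (π' s a) = Real.log (π s a) + y s a := fun a => by
    rw [hy, Real.log_mul (hpos s a).ne' (Real.exp_pos _).ne', Real.log_exp]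
  -- Four second-order errors: linearising the tilt, linearising the action value, the product of
  -- the two changes, and the entropy. The first-order change of log π has mean zero, which is why
  -- the first variation contains no separate entropy term.
  have hdecomp : actionMean π' (M.softActionValue lam v π') s -
        actionMean π (M.softActionValue lam v π) s - M.firstVariation lam Gr GP v π u s =
      actionMean π (fun s a => (δ s a - centered π u s a) * M.softActionValue lam v π s a) s +
      actionMean π (fun s a => M.actionValue v π' s a - M.actionValue v π s a -
        gradForm (M.actionValueGradient Gr GP v π s a) (fun s a => π s a * centered π u s a)) s +
      actionMean π (fun s a => δ s a * (M.actionValue v π' s a - M.actionValue v π s a)) s -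
      lam * actionMean π' y s := by
    simp only [PeMDP.firstVariation, actionMean, Finset.mul_sum, ← Finset.sum_add_distrib,
      ← Finset.sum_sub_distrib]
    refine Finset.sum_congr rfl fun a _ => ?_
    have e : π' s a = π s a + π s a * δ s a := by rw [← hd]; ring
    simp only [PeMDP.softActionValue, hlog]
    rw [e]
    ring
  have b1 : |actionMean π (fun s a => (δ s a - centered π u s a) *
      M.softActionValue lam v π s a) s| ≤ 8 * τ ^ 2 * (Q + lam * Fintype.card A) :=
    abs_actionMean_mul_le (y := fun s a => δ s a - centered π u s a)
      (by positivity) (hy2 s) (sum_abs_mul_softActionValue_le hlam hπ (hQ s))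
  have b2 : |actionMean π (fun s a => M.actionValue v π' s a - M.actionValue v π s a -
        gradForm (M.actionValueGradient Gr GP v π s a) (fun s a => π s a * centered π u s a)) s| ≤
      16 * K * τ ^ 2 + 8 * L * τ ^ 2 := by
    refine abs_actionMean_le hπ fun a => ?_
    have e : M.actionValue v π' s a - M.actionValue v π s a -
        gradForm (M.actionValueGradient Gr GP v π s a) (fun s a => π s a * centered π u s a) =
        (M.actionValue v π' s a - M.actionValue v π s a -
          gradForm (M.actionValueGradient Gr GP v π s a) (π' - π)) +
        gradForm (M.actionValueGradient Gr GP v π s a)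
          (fun s a => π s a * (δ s a - centered π u s a)) := by
      have : (fun s a => π s a * (δ s a - centered π u s a)) =
          (π' - π) - fun s a => π s a * centered π u s a := by
        funext s a
        simp only [Pi.sub_apply, hd]
        ring
      rw [this, map_sub _ (π' - π)]
      ring
    rw [e]
    refine (abs_add_le _ _).trans (add_le_add ?_ ?_)
    · refine ((hq s a).abs_remainder_le hK hπ hπ').trans ?_
      have := mul_le_mul_of_nonneg_left (pow_le_pow_left₀ (norm_nonneg _) hnorm 2) hK
      calc _ ≤ _ := this
        _ = _ := by ring
    · have h0 : ∀ s, actionMean π (fun s a => δ s a - centered π u s a) s = 0 := fun s => by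
        rw [actionMean_sub, hδ0, actionMean_centered hπ, sub_self]
      refine ((hq s a).abs_gradForm_mul_le hK hπ h0).trans ?_
      have : ‖fun s a => π s a * (δ s a - centered π u s a)‖ ≤ 8 * τ ^ 2 :=
        norm_le_of_abs_le (by positivity) fun s a => by
          rw [abs_mul, abs_of_pos (hpos s a)]
          exact (mul_le_of_le_one_left (abs_nonneg _) (policy_le_one hπ s a)).trans (hy2 s a)
      calc _ ≤ L * (8 * τ ^ 2) := mul_le_mul_of_nonneg_left this hL
        _ = _ := by ring
  have b3 : |actionMean π (fun s a => δ s a * (M.actionValue v π' s a - M.actionValue v π s a)) s| ≤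
      16 * L * τ ^ 2 := by
    refine abs_actionMean_le hπ fun a => ?_
    rw [abs_mul]
    have h1 := (hq s a).lipschitz _ hπ' _ hπ
    have h2 := h1.trans (mul_le_mul_of_nonneg_left hnorm hL)
    have h3 := mul_le_mul (hy1 s a) h2 (abs_nonneg _) (by linarith)
    calc _ ≤ _ := h3
      _ = _ := by ring
  have b4 : |lam * actionMean π' y s| ≤ lam * (12 * τ ^ 2) := by
    rw [abs_mul, abs_of_nonneg hlam]
    exact mul_le_mul_of_nonneg_left (hy3 s) hlam
  rw [hdecomp]
  rw [abs_le] at b1 b2 b3 b4 ⊢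
  constructor <;> linarith

end Estimates

end FirstVariation

/-! ### Change of the visitation measure, and the derivative of the value -/

section Remainder

variable {S A : Type*} [Fintype S] [Fintype A]

/-- A resolvent identity: x solves the Bellman equation of the old chain with reward w, and testing
the flow equations of both chains on the same x leaves only the difference of the one-step
operators. -/
lemma sum_visitation_sub_of_bellman {γ : ℝ} {P P' : S → A → S → ℝ} {π π' : S → A → ℝ} {ρ : S → ℝ}
    (hγ0 : 0 ≤ γ) (hγ1 : γ < 1)
    (hP : ∀ s a, P s a ∈ stdSimplex ℝ S) (hP' : ∀ s a, P' s a ∈ stdSimplex ℝ S)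
    (hπ : π ∈ Policies S A) (hπ' : π' ∈ Policies S A) (hρ : ρ ∈ stdSimplex ℝ S) {w x : S → ℝ}
    (hx : ∀ s, x s = w s + γ * actionMean π (lookahead P x) s) :
    ∑ s, visitation γ P' π' ρ s * w s - ∑ s, visitation γ P π ρ s * w s =
      γ * ∑ s, visitation γ P' π' ρ s *
        (actionMean π' (lookahead P' x) s - actionMean π (lookahead P x) s) := by
  have h1 := sum_visitation_mul_sub hγ0 hγ1 hP hπ hρ x
  have h2 := sum_visitation_mul_sub hγ0 hγ1 hP' hπ' hρ x
  have h3 : ∑ s, visitation γ P π ρ s * w s = ∑ s, ρ s * x s := by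
    rw [← h1]
    exact Finset.sum_congr rfl fun s _ => by rw [← eq_sub_of_add_eq (hx s).symm]
  rw [h3, ← h2, Finset.mul_sum, ← Finset.sum_sub_distrib]
  refine Finset.sum_congr rfl fun s _ => ?_
  rw [eq_sub_of_add_eq (hx s).symm]
  ring

/-- The transition matrices of two policies, in the environments they induce, on a bounded
function. -/
lemma PeMDP.IsSmooth.abs_lookahead_sub_le {M : PeMDP S A} {Rmax Lr Lp R2 T2 : ℝ}
    (hM : M.IsSmooth Rmax Lr Lp R2 T2) (hLp : 0 ≤ Lp) {π π' : S → A → ℝ} (hπ : π ∈ Policies S A)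
    (hπ' : π' ∈ Policies S A) {τ : ℝ} (hτ : ‖π' - π‖ ≤ τ) {x : S → ℝ} {c : ℝ} (hc : 0 ≤ c)
    (hx : ∀ s, |x s| ≤ c) (s : S) :
    |actionMean π' (lookahead (M.trans π') x) s - actionMean π' (lookahead (M.trans π) x) s| ≤
      Lp * τ * c := by
  rw [← actionMean_sub]
  refine abs_actionMean_le hπ' fun a => ?_
  have h := abs_lookahead_le (P := fun s a s' => M.trans π' s a s' - M.trans π s a s')
    ((hM.trans_lipschitz π' hπ' π hπ s a).trans (mul_le_mul_of_nonneg_left hτ hLp)) hc hx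
  simpa only [lookahead, sub_mul, Finset.sum_sub_distrib] using h

lemma abs_actionMean_sub_le {π π' δ : S → A → ℝ} (hπ : π ∈ Policies S A) {τ : ℝ}
    (hd : ∀ s a, π' s a - π s a = π s a * δ s a) (hδ : ∀ s a, |δ s a| ≤ τ) {y : S → A → ℝ}
    {c : ℝ} (hτ : 0 ≤ τ) {s : S} (hy : ∀ a, |y s a| ≤ c) :
    |actionMean π' y s - actionMean π y s| ≤ τ * c := by
  have e : actionMean π' y s - actionMean π y s = actionMean π (fun s a => δ s a * y s a) s := by
    simp only [actionMean, ← Finset.sum_sub_distrib, ← sub_mul, hd]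
    exact Finset.sum_congr rfl fun a _ => by ring
  rw [e]
  refine abs_actionMean_le hπ fun a => ?_
  rw [abs_mul]
  exact mul_le_mul (hδ s a) (hy a) (abs_nonneg _) hτ

namespace PeMDP

/-- Lipschitz continuity of the visitation measure along the softmax policies. -/
lemma IsSmooth.abs_sum_visitation_sub_le [Nonempty S] [Nonempty A] {M : PeMDP S A}
    {Rmax Lr Lp R2 T2 : ℝ} (hM : M.IsSmooth Rmax Lr Lp R2 T2) (hLp : 0 ≤ Lp)
    {π π' δ : S → A → ℝ} (hπ : π ∈ Policies S A) (hπ' : π' ∈ Policies S A) {ρ : S → ℝ}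
    (hρ : ρ ∈ stdSimplex ℝ S) {τ : ℝ} (hτ : 0 ≤ τ)
    (hd : ∀ s a, π' s a - π s a = π s a * δ s a) (hδ : ∀ s a, |δ s a| ≤ τ)
    (hnorm : ‖π' - π‖ ≤ τ) {y : S → ℝ} {c : ℝ} (hc : 0 ≤ c) (hy : ∀ s, |y s| ≤ c) :
    |∑ s, visitation M.discount (M.trans π') π' ρ s * y s -
        ∑ s, visitation M.discount (M.trans π) π ρ s * y s| ≤
      (1 + Lp) * τ * c / (1 - M.discount) ^ 2 := by
  have hγ0 := M.discount_pos.le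
  have hγ1 := M.discount_lt_one
  have hg : 0 < 1 - M.discount := by linarith
  obtain ⟨x, hx⟩ := exists_bellman hγ0 hγ1 (M.trans_mem π hπ) hπ y
  have hxb := abs_le_of_bellman hγ0 hγ1 (M.trans_mem π hπ) hπ hx hy
  have hc' : 0 ≤ c / (1 - M.discount) := by positivity
  rw [sum_visitation_sub_of_bellman hγ0 hγ1 (M.trans_mem π hπ) (M.trans_mem π' hπ') hπ hπ' hρ hx,
    abs_mul, abs_of_nonneg hγ0]
  have h1 : ∀ s, |actionMean π' (lookahead (M.trans π') x) s -
      actionMean π (lookahead (M.trans π) x) s| ≤ (1 + Lp) * τ * (c / (1 - M.discount)) :=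
    fun s => by
      have h2 := hM.abs_lookahead_sub_le hLp hπ hπ' hnorm hc' hxb s
      have h3 := abs_actionMean_sub_le hπ hd hδ hτ (y := lookahead (M.trans π) x) (s := s)
        fun a => by
          have := abs_lookahead_le (P := M.trans π) (s := s) (a := a)
            (sum_abs_of_mem_stdSimplex (M.trans_mem π hπ s a)).le hc' hxb
          rwa [one_mul] at this
      rw [abs_le] at h2 h3 ⊢
      constructor <;> linarith
  have h4 := abs_sum_visitation_mul_le hγ0 hγ1 (M.trans_mem π' hπ') hπ' hρ h1
  refine (mul_le_of_le_one_left (abs_nonneg _) hγ1.le).trans (h4.trans (le_of_eq ?_))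
  field_simp

section

variable {M : PeMDP S A} {lam L K : ℝ} {Gr : (S → A → ℝ) → S → A → (S → A → ℝ)}
  {GP : (S → A → ℝ) → S → A → S → (S → A → ℝ)} {v : S → ℝ} {π : S → A → ℝ}

/-- The first variation in terms of the advantage `softActionValue - v`. -/
lemma firstVariation_eq (hπ : π ∈ Policies S A) (u : S → A → ℝ) (s : S) :
    M.firstVariation lam Gr GP v π u s =
      actionMean π (fun s a => centered π u s a * (M.softActionValue lam v π s a - v s)) s +
      actionMean π (fun s a => gradForm (M.actionValueGradient Gr GP v π s a)
        (fun s a => π s a * centered π u s a)) s := by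
  have h : actionMean π (fun s a => centered π u s a * (M.softActionValue lam v π s a - v s)) s =
      actionMean π (fun s a => centered π u s a * M.softActionValue lam v π s a) s := by
    have h1 : (fun s a => centered π u s a * (M.softActionValue lam v π s a - v s)) = fun s a =>
      centered π u s a * M.softActionValue lam v π s a - v s * centered π u s a := by
      funext s a; ring
    have h2 : actionMean π (fun s a => v s * centered π u s a) s =
        v s * actionMean π (centered π u) s := by
      simp only [actionMean, Finset.mul_sum]
      exact Finset.sum_congr rfl fun a _ => by ring
    rw [h1, actionMean_sub, h2, actionMean_centered hπ]
    ring
  rw [firstVariation, h]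

/-- Centring allows the soft action value to be replaced by the advantage, so that the second-moment
bound applies instead of a sup bound of the order of the horizon. -/
lemma sq_firstVariation_le (hπ : π ∈ Policies S A) (hL : 0 ≤ L) (hK : 0 ≤ K)
    (hq : ∀ s a, IsSmoothPolicyFun (fun π => M.actionValue v π s a)
      (fun π => M.actionValueGradient Gr GP v π s a) L K) {u : S → A → ℝ} {τ : ℝ} (hτ : 0 ≤ τ)
    (hu : ∀ s a, |u s a| ≤ τ) (s : S) :
    M.firstVariation lam Gr GP v π u s ^ 2 ≤
      8 * τ ^ 2 * actionMean π (fun s a => (M.softActionValue lam v π s a - v s) ^ 2) s +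
        8 * τ ^ 2 * L ^ 2 := by
  have hc := abs_centered_le hπ hu
  have h1 := sq_actionMean_mul_le hπ (centered π u)
    (fun s a => M.softActionValue lam v π s a - v s) s
  have h2 : actionMean π (fun s a => centered π u s a ^ 2) s ≤ 4 * τ ^ 2 := by
    refine (abs_le.1 (abs_actionMean_le hπ fun a => ?_)).2
    rw [abs_pow]
    calc _ ≤ (2 * τ) ^ 2 := pow_le_pow_left₀ (abs_nonneg _) (hc s a) 2
      _ = _ := by ring
  have h3 : 0 ≤ actionMean π (fun s a => (M.softActionValue lam v π s a - v s) ^ 2) s :=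
    Finset.sum_nonneg fun a _ => mul_nonneg ((hπ s).1 a) (sq_nonneg _)
  have h4 := abs_actionMean_le hπ (s := s)
    (y := fun s a => gradForm (M.actionValueGradient Gr GP v π s a)
      (fun s a => π s a * centered π u s a))
    (abs_gradForm_centered_le hπ hL hK hq (by linarith) hc s)
  have h5 := pow_le_pow_left₀ (abs_nonneg _) h4 2
  rw [sq_abs] at h5
  have h6 := mul_le_mul_of_nonneg_right h2 h3
  rw [firstVariation_eq hπ]
  nlinarith [sq_nonneg (actionMean π (fun s a => centered π u s a *
      (M.softActionValue lam v π s a - v s)) s -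
    actionMean π (fun s a => gradForm (M.actionValueGradient Gr GP v π s a)
      (fun s a => π s a * centered π u s a)) s)]

end

lemma centered_add (π u w : S → A → ℝ) (s : S) (a : A) :
    centered π (fun s a => u s a + w s a) s a = centered π u s a + centered π w s a := by
  simp only [centered, actionMean_add]; ring

lemma centered_smul (π u : S → A → ℝ) (r : ℝ) (s : S) (a : A) :
    centered π (fun s a => r * u s a) s a = r * centered π u s a := by
  simp only [centered, actionMean_smul]; ring

lemma firstVariation_add (M : PeMDP S A) (lam : ℝ) (Gr : (S → A → ℝ) → S → A → (S → A → ℝ))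
    (GP : (S → A → ℝ) → S → A → S → (S → A → ℝ)) (v : S → ℝ) (π u w : S → A → ℝ) (s : S) :
    M.firstVariation lam Gr GP v π (fun s a => u s a + w s a) s =
      M.firstVariation lam Gr GP v π u s + M.firstVariation lam Gr GP v π w s := by
  simp only [firstVariation, centered_add, add_mul, mul_add, gradForm_apply,
    Finset.sum_add_distrib, actionMean_add]
  ring

lemma firstVariation_smul (M : PeMDP S A) (lam : ℝ) (Gr : (S → A → ℝ) → S → A → (S → A → ℝ))
    (GP : (S → A → ℝ) → S → A → S → (S → A → ℝ)) (v : S → ℝ) (π u : S → A → ℝ) (r : ℝ) (s : S) :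
    M.firstVariation lam Gr GP v π (fun s a => r * u s a) s =
      r * M.firstVariation lam Gr GP v π u s := by
  simp only [firstVariation, centered_smul, gradForm_apply, mul_left_comm _ r, mul_assoc,
    ← Finset.mul_sum, actionMean_smul]
  ring

/-- The derivative of the soft value at the softmax policy `π_θ` in the direction `h`. -/
noncomputable def valueDeriv (M : PeMDP S A) (lam : ℝ)
    (Gr : (S → A → ℝ) → S → A → (S → A → ℝ))
    (GP : (S → A → ℝ) → S → A → S → (S → A → ℝ)) (ρ : S → ℝ) (θ : EuclideanSpace ℝ (S × A)) :
    EuclideanSpace ℝ (S × A) →L[ℝ] ℝ :=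
  LinearMap.toContinuousLinearMap
    { toFun := fun h => ∑ s, visitation M.discount (M.trans (softmaxPolicy θ)) (softmaxPolicy θ) ρ s *
        M.firstVariation lam Gr GP (M.stateValue lam (softmaxPolicy θ)) (softmaxPolicy θ)
          (fun s a => h (s, a)) s
      map_add' := fun h k => by
        simp only [PiLp.add_apply, firstVariation_add, mul_add, Finset.sum_add_distrib]
      map_smul' := fun r h => by
        simp only [PiLp.smul_apply, smul_eq_mul, firstVariation_smul, mul_left_comm _ r,
          ← Finset.mul_sum, RingHom.id_apply] }

lemma valueDeriv_apply (M : PeMDP S A) (lam : ℝ) (Gr : (S → A → ℝ) → S → A → (S → A → ℝ))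
    (GP : (S → A → ℝ) → S → A → S → (S → A → ℝ)) (ρ : S → ℝ) (θ h : EuclideanSpace ℝ (S × A)) :
    M.valueDeriv lam Gr GP ρ θ h =
      ∑ s, visitation M.discount (M.trans (softmaxPolicy θ)) (softmaxPolicy θ) ρ s *
        M.firstVariation lam Gr GP (M.stateValue lam (softmaxPolicy θ)) (softmaxPolicy θ)
          (fun s a => h (s, a)) s := rfl

end PeMDP

end Remainder

/-! ### Smoothness of the soft value in the mild regime -/

section Smoothness

variable {S A : Type*} [Fintype S] [Fintype A]

lemma IsSmoothPolicyFun.mono {q : (S → A → ℝ) → ℝ} {G : (S → A → ℝ) → S → A → ℝ} {L K L' K' : ℝ}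
    (h : IsSmoothPolicyFun q G L K) (hL : L ≤ L') (hK : K ≤ K') : IsSmoothPolicyFun q G L' K' where
  grad := h.grad
  lipschitz π hπ π' hπ' := (h.lipschitz π hπ π' hπ').trans
    (mul_le_mul_of_nonneg_right hL (norm_nonneg _))
  smooth π hπ π' hπ' := (h.smooth π hπ π' hπ').trans
    (mul_le_mul_of_nonneg_right hK (norm_nonneg _))

namespace PeMDP

/-- The regime in which the effect of the policy on the environment is at most of the order of
`1 - γ`, and the regularisation is at most of the order of `(1 - γ) / log |A|`. -/
structure IsMild (M : PeMDP S A) (Rmax Lr Lp R2 T2 lam : ℝ) : Prop where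
  smooth : M.IsSmooth Rmax Lr Lp R2 T2
  Rmax_pos : 0 < Rmax
  Lp_nonneg : 0 ≤ Lp
  R2_nonneg : 0 ≤ R2
  T2_nonneg : 0 ≤ T2
  Lr_le : Lr ≤ 3 * Rmax * (1 - M.discount)
  Lp_le : Lp ≤ 3 * (1 - M.discount)
  lam_nonneg : 0 ≤ lam
  lam_le : lam * (1 + 2 * Real.log (Fintype.card A)) ≤ (1 - M.discount) * Rmax

namespace IsMild

variable {M : PeMDP S A} {Rmax Lr Lp R2 T2 lam : ℝ}

lemma one_le_card [Nonempty A] : (1 : ℝ) ≤ Fintype.card A := by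
  exact_mod_cast Fintype.card_pos

lemma lam_le_mul [Nonempty A] (hM : M.IsMild Rmax Lr Lp R2 T2 lam) :
    lam ≤ (1 - M.discount) * Rmax := by
  have h := mul_nonneg hM.lam_nonneg (Real.log_nonneg (one_le_card (A := A)))
  linarith [hM.lam_le]

lemma lam_le_Rmax [Nonempty A] (hM : M.IsMild Rmax Lr Lp R2 T2 lam) : lam ≤ Rmax := by
  have h := mul_pos M.discount_pos hM.Rmax_pos
  linarith [hM.lam_le_mul]

lemma lam_mul_log_le [Nonempty A] (hM : M.IsMild Rmax Lr Lp R2 T2 lam) :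
    lam * Real.log (Fintype.card A) ≤ Rmax / 2 := by
  have h := mul_pos M.discount_pos hM.Rmax_pos
  linarith [hM.lam_le, hM.lam_nonneg]

lemma abs_stateValue_le [Nonempty S] [Nonempty A] (hM : M.IsMild Rmax Lr Lp R2 T2 lam)
    {π : S → A → ℝ} (hπ : π ∈ Policies S A) (s : S) :
    |M.stateValue lam π s| ≤ 2 * Rmax / (1 - M.discount) := by
  have hg : 0 < 1 - M.discount := by linarith [M.discount_lt_one]
  refine (PeMDP.abs_stateValue_le hM.smooth hM.lam_nonneg hπ s).trans ?_
  gcongr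
  linarith [hM.lam_mul_log_le, hM.Rmax_pos]

lemma abs_actionValue_le [Nonempty S] [Nonempty A] (hM : M.IsMild Rmax Lr Lp R2 T2 lam)
    {π : S → A → ℝ} (hπ : π ∈ Policies S A) (s : S) (a : A) :
    |M.actionValue (M.stateValue lam π) π s a| ≤ 2 * Rmax / (1 - M.discount) := by
  have hg : 0 < 1 - M.discount := by linarith [M.discount_lt_one]
  have hR := hM.Rmax_pos
  refine (PeMDP.abs_actionValue_le hM.smooth hπ (by positivity) (hM.abs_stateValue_le hπ) s a).trans
    ?_
  have h1 := mul_pos hg hR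
  rw [le_div_iff₀ hg, add_mul, mul_assoc M.discount, div_mul_cancel₀ _ hg.ne']
  nlinarith

/-- Since L_P ≤ 3(1-γ), the horizon in the continuation values cancels in the Lipschitz constant: 3
R_max from the reward and 6 R_max from the kernel make 9 R_max. -/
lemma isSmoothPolicyFun (hM : M.IsMild Rmax Lr Lp R2 T2 lam)
    {Gr : (S → A → ℝ) → S → A → (S → A → ℝ)}
    {GP : (S → A → ℝ) → S → A → S → (S → A → ℝ)} (hG : M.HasLipschitzGradients Gr GP R2 T2)
    {v : S → ℝ} (hv : ∀ s, |v s| ≤ 2 * Rmax / (1 - M.discount)) (s : S) (a : A) :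
    IsSmoothPolicyFun (fun π => M.actionValue v π s a)
      (fun π => M.actionValueGradient Gr GP v π s a) (9 * Rmax)
      ((R2 + 2 * T2 * Rmax) / (1 - M.discount)) := by
  have hg : 0 < 1 - M.discount := by linarith [M.discount_lt_one]
  have hγ := M.discount_pos
  have hγ1 := M.discount_lt_one
  have hR := hM.Rmax_pos
  have hc : 0 ≤ 2 * Rmax / (1 - M.discount) := by positivity
  refine (isSmoothPolicyFun_actionValue hM.smooth hG.reward hG.reward_lipschitz hG.trans
    hG.trans_lipschitz hc hv s a).mono ?_ ?_
  · have h1 : M.discount * Lp * (2 * Rmax / (1 - M.discount)) ≤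
        1 * (3 * (1 - M.discount)) * (2 * Rmax / (1 - M.discount)) := by
      gcongr
      · exact hM.Lp_nonneg
      · exact hM.Lp_le
    have h2 : 1 * (3 * (1 - M.discount)) * (2 * Rmax / (1 - M.discount)) = 6 * Rmax := by
      field_simp; ring
    have h3 : 3 * Rmax * (1 - M.discount) ≤ 3 * Rmax := by nlinarith
    linarith [hM.Lr_le]
  · have h1 : M.discount * T2 * (2 * Rmax / (1 - M.discount)) ≤
        1 * T2 * (2 * Rmax / (1 - M.discount)) := by
      have := hM.T2_nonneg
      gcongr
    have h2 : R2 ≤ R2 / (1 - M.discount) := by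
      rw [le_div_iff₀ hg]
      nlinarith [hM.R2_nonneg]
    have h3 : (R2 + 2 * T2 * Rmax) / (1 - M.discount) =
        R2 / (1 - M.discount) + 1 * T2 * (2 * Rmax / (1 - M.discount)) := by ring
    linarith

section

variable {Gr : (S → A → ℝ) → S → A → (S → A → ℝ)} {GP : (S → A → ℝ) → S → A → S → (S → A → ℝ)}
  {ρ : S → ℝ}

/-- The variance bound gives |A|/(1-γ)², where squaring the sup bound would give |A|²/(1-γ)³. The
constant is 8·10 from the soft rewards plus 8·9² from the environment. -/
lemma sum_visitation_sq_firstVariation_le [Nonempty S] [Nonempty A]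
    (hM : M.IsMild Rmax Lr Lp R2 T2 lam) (hG : M.HasLipschitzGradients Gr GP R2 T2)
    (hρ : ρ ∈ stdSimplex ℝ S) {π u : S → A → ℝ} (hπ : π ∈ Policies S A) {τ : ℝ} (hτ : 0 ≤ τ)
    (hu : ∀ s a, |u s a| ≤ τ) :
    ∑ s, visitation M.discount (M.trans π) π ρ s *
        M.firstVariation lam Gr GP (M.stateValue lam π) π u s ^ 2 ≤
      728 * τ ^ 2 * Rmax ^ 2 * Fintype.card A / (1 - M.discount) ^ 2 := by
  have hγ0 := M.discount_pos.le
  have hγ1 := M.discount_lt_one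
  have hg : 0 < 1 - M.discount := by linarith
  have hR := hM.Rmax_pos
  have hN := one_le_card (A := A)
  have hP := M.trans_mem π hπ
  set g := 1 - M.discount with hgdef
  set N : ℝ := (Fintype.card A : ℝ)
  set v := M.stateValue lam π with hv
  have hK : 0 ≤ (R2 + 2 * T2 * Rmax) / g := by
    have := hM.R2_nonneg
    have := hM.T2_nonneg
    positivity
  have h1 := sq_firstVariation_le (lam := lam) hπ (by linarith : 0 ≤ 9 * Rmax) hK
    (hM.isSmoothPolicyFun hG (hM.abs_stateValue_le hπ)) hτ hu
  have h2 := sum_visitation_sq_advantage_le hγ0 hγ1 hP hπ hρ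
    (q := M.softActionValue lam v π) (f := M.softReward lam π) (x := v)
    (fun s a => M.softActionValue_eq lam v π s a) (fun s => M.stateValue_eq lam hπ s)
  have h3 : ∀ s, actionMean π (fun s a => M.softReward lam π s a ^ 2) s ≤ 10 * Rmax ^ 2 * N :=
    fun s => by
      have h4 := actionMean_sq_softReward_le (lam := lam) hM.smooth hπ s
      have h5 : lam ^ 2 ≤ Rmax ^ 2 := pow_le_pow_left₀ hM.lam_nonneg hM.lam_le_Rmax 2
      have h6 : 8 * lam ^ 2 * N ≤ 8 * Rmax ^ 2 * N := by gcongr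
      have h7 : 2 * Rmax ^ 2 ≤ 2 * Rmax ^ 2 * N := le_mul_of_one_le_right (by positivity) hN
      linarith
  have h4 := sum_visitation_mul_le hγ0 hγ1 hP hπ hρ h3
  have h5 : ∑ s, visitation M.discount (M.trans π) π ρ s *
      actionMean π (fun s a => (M.softActionValue lam v π s a - v s) ^ 2) s ≤
      10 * Rmax ^ 2 * N / g / g := h2.trans (by gcongr)
  have h7 : ∀ s, visitation M.discount (M.trans π) π ρ s *
      (8 * τ ^ 2 * actionMean π (fun s a => (M.softActionValue lam v π s a - v s) ^ 2) s +
        8 * τ ^ 2 * (9 * Rmax) ^ 2) =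
      8 * τ ^ 2 * (visitation M.discount (M.trans π) π ρ s *
        actionMean π (fun s a => (M.softActionValue lam v π s a - v s) ^ 2) s) +
      visitation M.discount (M.trans π) π ρ s * (648 * τ ^ 2 * Rmax ^ 2) := fun s => by ring
  refine (Finset.sum_le_sum fun s _ => (mul_le_mul_of_nonneg_left (h1 s)
    (visitation_nonneg hγ0 hP hπ hρ s)).trans_eq (h7 s)).trans ?_
  simp only [Finset.sum_add_distrib, ← Finset.mul_sum, ← Finset.sum_mul,
    sum_visitation hγ0 hγ1 hP hπ hρ]
  have h8 := mul_le_mul_of_nonneg_left h5 (by positivity : 0 ≤ 8 * τ ^ 2)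
  have hg1 : g ≤ 1 := by linarith
  have h9 : 1 / g * (648 * τ ^ 2 * Rmax ^ 2) ≤ 648 * τ ^ 2 * Rmax ^ 2 * N / g ^ 2 := by
    have : 1 / g * (648 * τ ^ 2 * Rmax ^ 2) = 648 * τ ^ 2 * Rmax ^ 2 * g / g ^ 2 := by
      field_simp
    rw [this]
    gcongr
    linarith
  calc _ ≤ 8 * τ ^ 2 * (10 * Rmax ^ 2 * N / g / g) + 648 * τ ^ 2 * Rmax ^ 2 * N / g ^ 2 :=
        add_le_add h8 h9
    _ = _ := by field_simp; ring

/-- Second moments bound the interaction of the change `δ` of the policy with the first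
variation. -/
lemma abs_sum_visitation_firstVariation_le [Nonempty S] [Nonempty A]
    (hM : M.IsMild Rmax Lr Lp R2 T2 lam) (hG : M.HasLipschitzGradients Gr GP R2 T2)
    (hρ : ρ ∈ stdSimplex ℝ S) {π π' u δ : S → A → ℝ} (hπ : π ∈ Policies S A)
    (hπ' : π' ∈ Policies S A) {τ : ℝ}
    (hτ : 0 ≤ τ) (hu : ∀ s a, |u s a| ≤ τ) (hd : ∀ s a, π' s a - π s a = π s a * δ s a)
    (hδ : ∀ s a, |δ s a| ≤ 4 * τ) {x : S → ℝ}
    (hx : ∀ s, x s = M.firstVariation lam Gr GP (M.stateValue lam π) π u s +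
      M.discount * actionMean π (lookahead (M.trans π) x) s) :
    |M.discount * ∑ s, visitation M.discount (M.trans π) π ρ s *
      (actionMean π' (lookahead (M.trans π) x) s - actionMean π (lookahead (M.trans π) x) s)| ≤
      108 * τ ^ 2 * Rmax * Fintype.card A / (1 - M.discount) ^ 2 := by
  have hγ0 := M.discount_pos.le
  have hγ1 := M.discount_lt_one
  have hg : 0 < 1 - M.discount := by linarith
  have hR := hM.Rmax_pos
  have hN := one_le_card (A := A)
  have hP := M.trans_mem π hπ
  have hw := hM.sum_visitation_sq_firstVariation_le hG hρ hπ hτ hu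
  set g := 1 - M.discount with hgdef
  set N : ℝ := (Fintype.card A : ℝ)
  set w := M.firstVariation lam Gr GP (M.stateValue lam π) π u
  set q : S → A → ℝ := fun s a => w s + M.discount * lookahead (M.trans π) x s a with hqdef
  have hxq : ∀ s, x s = actionMean π q s := fun s => by
    rw [hqdef, actionMean_add, actionMean_smul, actionMean_const hπ w, ← hx s]
  have hδ0 : ∀ s, actionMean π δ s = 0 := fun s => by
    simp only [actionMean, ← hd, Finset.sum_sub_distrib, (hπ s).2, (hπ' s).2, sub_self]
  -- As δ has mean zero under π, any function of the state may be added to the lookahead; this turns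
  -- it into the advantage q - x.
  have e : M.discount * ∑ s, visitation M.discount (M.trans π) π ρ s *
      (actionMean π' (lookahead (M.trans π) x) s - actionMean π (lookahead (M.trans π) x) s) =
      ∑ s, visitation M.discount (M.trans π) π ρ s *
        actionMean π (fun s a => δ s a * (q s a - x s)) s := by
    rw [Finset.mul_sum]
    refine Finset.sum_congr rfl fun s _ => ?_
    have h1 : actionMean π (fun s a => δ s a * (q s a - x s)) s =
        M.discount * actionMean π (fun s a => δ s a * lookahead (M.trans π) x s a) s +
          (w s - x s) * actionMean π δ s := by
      simp only [actionMean, Finset.mul_sum, ← Finset.sum_add_distrib, hqdef]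
      exact Finset.sum_congr rfl fun a _ => by ring
    have h2 : actionMean π' (lookahead (M.trans π) x) s - actionMean π (lookahead (M.trans π) x) s =
        actionMean π (fun s a => δ s a * lookahead (M.trans π) x s a) s := by
      simp only [actionMean, ← Finset.sum_sub_distrib, ← sub_mul, hd]
      exact Finset.sum_congr rfl fun a _ => by ring
    rw [h1, h2, hδ0]
    ring
  rw [e]
  have h1 := sq_sum_visitation_mul_le hγ0 hP hπ hρ δ (fun s a => q s a - x s)
  have h2 := sum_visitation_sq_advantage_le hγ0 hγ1 hP hπ hρ (q := q) (f := fun s _ => w s)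
    (x := x) (fun s a => rfl) hxq
  have h3 : ∀ s, actionMean π (fun s _ => w s ^ 2) s = w s ^ 2 :=
    actionMean_const hπ (fun s => w s ^ 2)
  simp only [h3] at h2
  have h4 : ∑ s, visitation M.discount (M.trans π) π ρ s *
      actionMean π (fun s a => δ s a ^ 2) s ≤ 16 * τ ^ 2 / g := by
    refine sum_visitation_mul_le hγ0 hγ1 hP hπ hρ fun s => ?_
    refine (abs_le.1 (abs_actionMean_le hπ fun a => ?_)).2
    rw [abs_pow]
    calc _ ≤ (4 * τ) ^ 2 := pow_le_pow_left₀ (abs_nonneg _) (hδ s a) 2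
      _ = _ := by ring
  have h5 : (∑ s, visitation M.discount (M.trans π) π ρ s * w s ^ 2) / g ≤
      728 * τ ^ 2 * Rmax ^ 2 * N / g ^ 2 / g := by gcongr
  have h6 : 0 ≤ ∑ s, visitation M.discount (M.trans π) π ρ s *
      actionMean π (fun s a => (q s a - x s) ^ 2) s :=
    Finset.sum_nonneg fun s _ => mul_nonneg (visitation_nonneg hγ0 hP hπ hρ s)
      (Finset.sum_nonneg fun a _ => mul_nonneg ((hπ s).1 a) (sq_nonneg _))
  have h7 := h1.trans (mul_le_mul h4 (h2.trans h5) h6 (by positivity))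
  refine abs_le_of_sq_le_sq (h7.trans ?_) (by positivity)
  -- The constant 108 is chosen because 16·728 = 11648 ≤ 108².
  have h8 : 16 * τ ^ 2 / g * (728 * τ ^ 2 * Rmax ^ 2 * N / g ^ 2 / g) =
      11648 * τ ^ 4 * Rmax ^ 2 * N / g ^ 4 := by field_simp; ring
  have h9 : (108 * τ ^ 2 * Rmax * N / g ^ 2) ^ 2 = 11664 * τ ^ 4 * Rmax ^ 2 * N ^ 2 / g ^ 4 := by
    field_simp; ring
  rw [h8, h9]
  have h10 : N ≤ N ^ 2 := by nlinarith
  gcongr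
  norm_num

/-- Second-order estimate for the soft value along the softmax policies. -/
theorem abs_softValue_remainder_le [Nonempty S] [Nonempty A]
    (hM : M.IsMild Rmax Lr Lp R2 T2 lam) (hG : M.HasLipschitzGradients Gr GP R2 T2)
    (hρ : ρ ∈ stdSimplex ℝ S) (θ h : EuclideanSpace ℝ (S × A)) (hh : ‖h‖ ≤ 1 / 2) :
    |M.softValue lam ρ (softmaxPolicy (θ + h)) - M.softValue lam ρ (softmaxPolicy θ) -
        M.valueDeriv lam Gr GP ρ θ h| ≤
      (648 * Rmax + 16 * R2 + 32 * T2 * Rmax) * Fintype.card A / (1 - M.discount) ^ 2 * ‖h‖ ^ 2 +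
      384 * (1 + Lp) * Rmax * Fintype.card A / (1 - M.discount) ^ 4 * ‖h‖ ^ 3 := by
  have hγ0 := M.discount_pos.le
  have hγ1 := M.discount_lt_one
  have hg : 0 < 1 - M.discount := by linarith
  have hR := hM.Rmax_pos
  have hN := one_le_card (A := A)
  have hlam0 := hM.lam_nonneg
  have hlam := hM.lam_le_Rmax
  have hLp := hM.Lp_nonneg
  have hR2 := hM.R2_nonneg
  have hT2 := hM.T2_nonneg
  obtain ⟨y, hy, -, hy1, -, -⟩ := exists_softmaxPolicy_add θ h le_rfl hh
  have hπ := softmaxPolicy_mem θ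
  have hπ' := softmaxPolicy_mem (θ + h)
  have hpos := softmaxPolicy_pos θ
  have hK : 0 ≤ (R2 + 2 * T2 * Rmax) / (1 - M.discount) := by positivity
  have hq := hM.isSmoothPolicyFun hG (hM.abs_stateValue_le hπ)
  have hQ := hM.abs_actionValue_le hπ
  have hbackup := abs_backup_remainder_le hlam0 (by linarith : 0 ≤ 9 * Rmax) hK hq θ h le_rfl hh hQ
  have hu : ∀ s a, |h (s, a)| ≤ ‖h‖ := fun s a => by
    have := PiLp.norm_apply_le h (s, a)
    rwa [Real.norm_eq_abs] at this
  have hτ := norm_nonneg h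
  have hwb := abs_firstVariation_le hπ hlam0 (by linarith : 0 ≤ 9 * Rmax) hK hq hQ hτ hu
  have hsv := M.stateValue_eq lam hπ
  rw [valueDeriv_apply, M.softValue_eq lam hρ hπ]
  set π := softmaxPolicy θ with hπdef
  set π' := softmaxPolicy (θ + h) with hπ'def
  set u : S → A → ℝ := fun s a => h (s, a)
  set v := M.stateValue lam π
  set w := M.firstVariation lam Gr GP v π u
  set g := 1 - M.discount with hgdef
  set N : ℝ := (Fintype.card A : ℝ)
  set τ := ‖h‖
  have hg1 : g ≤ 1 := by linarith
  set δ : S → A → ℝ := fun s a => Real.exp (y s a) - 1 with hδ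
  have hd : ∀ s a, π' s a - π s a = π s a * δ s a := fun s a => by
    simp only [hδ]; rw [hy]; ring
  have hnorm : ‖π' - π‖ ≤ 4 * τ := norm_le_of_abs_le (by linarith) fun s a => by
    rw [Pi.sub_apply, Pi.sub_apply, hd, abs_mul, abs_of_pos (hpos s a)]
    exact (mul_le_of_le_one_left (abs_nonneg _) (policy_le_one hπ s a)).trans (hy1 s a)
  -- Decomposition of the remainder.
  obtain ⟨x, hx⟩ := exists_bellman hγ0 hγ1 (M.trans_mem π hπ) hπ w
  set m := visitation M.discount (M.trans π) π ρ
  set m' := visitation M.discount (M.trans π') π' ρ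
  set y₁ : S → ℝ := fun s =>
    actionMean π' (lookahead (M.trans π) x) s - actionMean π (lookahead (M.trans π) x) s with hy₁
  set z₁ : S → ℝ := fun s =>
    actionMean π' (lookahead (M.trans π') x) s - actionMean π' (lookahead (M.trans π) x) s with hz₁
  set b : S → ℝ := fun s => actionMean π' (M.softActionValue lam v π') s -
    actionMean π (M.softActionValue lam v π) s - w s with hb
  have h1 : M.softValue lam ρ π' - ∑ s, ρ s * v s = ∑ s, m' s * (b s + w s) := by
    refine (discountedReturn_sub hγ0 hγ1 (M.trans_mem π' hπ') hπ' hρ _ v).trans ?_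
    refine Finset.sum_congr rfl fun s _ => ?_
    have e : (fun s a => M.reward π' s a - lam * Real.log (π' s a) +
        M.discount * lookahead (M.trans π') v s a) = M.softActionValue lam v π' := by
      funext s a
      rw [softActionValue_eq]; rfl
    rw [e, hsv s, hb]
    ring
  have h2 : ∑ s, m' s * w s - ∑ s, m s * w s = M.discount * ∑ s, m' s *
      (actionMean π' (lookahead (M.trans π') x) s - actionMean π (lookahead (M.trans π) x) s) :=
    sum_visitation_sub_of_bellman hγ0 hγ1 (M.trans_mem π hπ) (M.trans_mem π' hπ') hπ hπ' hρ hx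
  -- The four terms are: the backup remainder; the change of kernel; the change of policy seen
  -- through the change of visitation, which is cubic; and the change of policy under the old
  -- visitation, which is the delicate quadratic term.
  have h3 : M.softValue lam ρ π' - ∑ s, ρ s * v s - ∑ s, m s * w s =
      ∑ s, m' s * b s + M.discount * ∑ s, m' s * z₁ s +
        M.discount * (∑ s, m' s * y₁ s - ∑ s, m s * y₁ s) + M.discount * ∑ s, m s * y₁ s := by
    rw [h1]
    have e : ∀ s, m' s * (actionMean π' (lookahead (M.trans π') x) s -
        actionMean π (lookahead (M.trans π) x) s) = m' s * z₁ s + m' s * y₁ s := fun s => by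
      simp only [hy₁, hz₁]; ring
    simp only [e, Finset.sum_add_distrib] at h2
    simp only [mul_add, Finset.sum_add_distrib]
    linarith
  -- Bounds for the four terms.
  have hlamN : lam * N ≤ Rmax * N / g := by
    rw [le_div_iff₀ hg]
    have : lam * N * g ≤ lam * N * 1 := by gcongr
    have : lam * N ≤ Rmax * N := by gcongr
    linarith
  have hRN : Rmax ≤ Rmax * N / g := by
    rw [le_div_iff₀ hg]
    have : Rmax * g ≤ Rmax * 1 := by gcongr
    have : Rmax * 1 ≤ Rmax * N := by gcongr
    linarith
  have hdiv : ∀ c : ℝ, 0 ≤ c → c / g ≤ c * N / g := fun c hc => by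
    gcongr
    exact le_mul_of_one_le_right hc hN
  -- The constant is 2 · (2 + 1 + 9): action value, entropy and environment in the bound for the
  -- first variation.
  set W := 24 * τ * Rmax * N / g with hW
  have hW0 : 0 ≤ W := by positivity
  have hwW : ∀ s, |w s| ≤ W := fun s => by
    refine (hwb s).trans ?_
    have h4 : 2 * Rmax / g + lam * N + 9 * Rmax ≤ 12 * (Rmax * N / g) := by
      have h5 := hdiv (2 * Rmax) (by positivity)
      have h6 : 2 * Rmax * N / g = 2 * (Rmax * N / g) := by ring
      linarith
    calc _ ≤ 2 * τ * (12 * (Rmax * N / g)) := by gcongr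
      _ = W := by rw [hW]; ring
  have hxW := abs_le_of_bellman hγ0 hγ1 (M.trans_mem π hπ) hπ hx hwW
  have hWg : 0 ≤ W / g := by positivity
  have t1 : |∑ s, m' s * b s| ≤
      (252 * Rmax + 16 * R2 + 32 * T2 * Rmax) * N / g ^ 2 * τ ^ 2 := by
    refine (abs_sum_visitation_mul_le hγ0 hγ1 (M.trans_mem π' hπ') hπ' hρ hbackup).trans ?_
    have h4 : 8 * (2 * Rmax / g + lam * N) + 12 * lam + 16 * ((R2 + 2 * T2 * Rmax) / g) +
        24 * (9 * Rmax) ≤ (252 * Rmax + 16 * R2 + 32 * T2 * Rmax) * N / g := by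
      have h5 := hdiv (2 * Rmax) (by positivity)
      have h6 := hdiv (R2 + 2 * T2 * Rmax) (by positivity)
      have h7 : (252 * Rmax + 16 * R2 + 32 * T2 * Rmax) * N / g =
        252 * (Rmax * N / g) + 16 * ((R2 + 2 * T2 * Rmax) * N / g) := by ring
      have h8 : 2 * Rmax * N / g = 2 * (Rmax * N / g) := by ring
      linarith
    calc _ ≤ (252 * Rmax + 16 * R2 + 32 * T2 * Rmax) * N / g * τ ^ 2 / g := by gcongr
      _ = _ := by field_simp
  -- Here L_P ≤ 3g pays for one of the three horizon factors.
  have t2 : |M.discount * ∑ s, m' s * z₁ s| ≤ 288 * Rmax * N / g ^ 2 * τ ^ 2 := by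
    have h4 : ∀ s, |z₁ s| ≤ 12 * g * τ * (W / g) := fun s => by
      refine (hM.smooth.abs_lookahead_sub_le hLp hπ hπ' hnorm hWg hxW s).trans ?_
      have h5 : Lp * (4 * τ) ≤ 3 * g * (4 * τ) := by
        have := hM.Lp_le
        gcongr
      calc _ ≤ 3 * g * (4 * τ) * (W / g) := by gcongr
        _ = _ := by ring
    have h5 := abs_sum_visitation_mul_le hγ0 hγ1 (M.trans_mem π' hπ') hπ' hρ h4
    rw [abs_mul, abs_of_nonneg hγ0]
    refine (mul_le_of_le_one_left (abs_nonneg _) hγ1.le).trans (h5.trans (le_of_eq ?_))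
    rw [hW, ← hgdef]
    field_simp
    ring
  -- Crude sup bounds suffice: the power of g is irrelevant for a cubic term.
  have t3 : |M.discount * (∑ s, m' s * y₁ s - ∑ s, m s * y₁ s)| ≤
      384 * (1 + Lp) * Rmax * N / g ^ 4 * τ ^ 3 := by
    have h4 : ∀ s, |y₁ s| ≤ 4 * τ * (W / g) := fun s =>
      abs_actionMean_sub_le hπ hd hy1 (by linarith) fun a => by
        have := abs_lookahead_le (P := M.trans π) (s := s) (a := a)
          (sum_abs_of_mem_stdSimplex (M.trans_mem π hπ s a)).le hWg hxW
        rwa [one_mul] at this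
    have h5 := hM.smooth.abs_sum_visitation_sub_le hLp hπ hπ' hρ (by linarith : 0 ≤ 4 * τ) hd hy1
      hnorm (by positivity : 0 ≤ 4 * τ * (W / g)) h4
    rw [abs_mul, abs_of_nonneg hγ0]
    refine (mul_le_of_le_one_left (abs_nonneg _) hγ1.le).trans (h5.trans (le_of_eq ?_))
    rw [hW, ← hgdef]
    field_simp
    ring
  -- A sup bound would lose a horizon factor here, hence the second-moment estimate.
  have t4 : |M.discount * ∑ s, m s * y₁ s| ≤ 108 * Rmax * N / g ^ 2 * τ ^ 2 := by
    refine (hM.abs_sum_visitation_firstVariation_le hG hρ hπ hπ' hτ hu hd hy1 hx).trans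
      (le_of_eq ?_)
    ring
  rw [h3]
  have e : (648 * Rmax + 16 * R2 + 32 * T2 * Rmax) * N / g ^ 2 * τ ^ 2 =
      (252 * Rmax + 16 * R2 + 32 * T2 * Rmax) * N / g ^ 2 * τ ^ 2 +
        288 * Rmax * N / g ^ 2 * τ ^ 2 + 108 * Rmax * N / g ^ 2 * τ ^ 2 := by ring
  rw [e]
  rw [abs_le] at t1 t2 t3 t4 ⊢
  constructor <;> linarith

end

end IsMild

end PeMDP

end Smoothness

/-! ### Gradient domination up to the performative bias, and convergence -/

section GradientDomination

variable {S A : Type*} [Fintype S] [Fintype A]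

namespace PeMDP

lemma occupancy_eq (M : PeMDP S A) (π' π : S → A → ℝ) (ρ : S → ℝ) (s : S) (a : A) :
    M.occupancy π' π ρ s a =
      (1 - M.discount) * (visitation M.discount (M.trans π') π ρ s * π s a) := by
  rw [occupancy, visitation, ← tsum_mul_right]
  simp only [mul_assoc]

/-- Only the member ν = ρ of the supremum is used. Because x / 0 = ∞ for x > 0, finite coverage also
forces absolute continuity. -/
lemma visitation_mul_le_of_coverage {M : PeMDP S A} {ρ : S → ℝ} (hρ : ρ ∈ stdSimplex ℝ S)
    {πstar : S → A → ℝ} {Θ : Set (EuclideanSpace ℝ (S × A))}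
    {N : Set (S → ℝ)} (hN : ρ ∈ N) {Cov : ℝ} (hCov : 0 ≤ Cov)
    (h : M.coverage ρ πstar Θ N = ENNReal.ofReal Cov) {θ : EuclideanSpace ℝ (S × A)} (hθ : θ ∈ Θ)
    [Nonempty A] (s : S) (a : A) :
    visitation M.discount (M.trans (softmaxPolicy θ)) πstar ρ s * πstar s a ≤
      Cov * (visitation M.discount (M.trans (softmaxPolicy θ)) (softmaxPolicy θ) ρ s *
        softmaxPolicy θ s a) := by
  have hg : 0 < 1 - M.discount := by linarith [M.discount_lt_one]
  have hπ := softmaxPolicy_mem θ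
  have h1 : ENNReal.ofReal (M.occupancy (softmaxPolicy θ) πstar ρ s a) /
      ENNReal.ofReal (M.occupancy (softmaxPolicy θ) (softmaxPolicy θ) ρ s a) ≤
      ENNReal.ofReal Cov := by
    rw [← h, coverage]
    refine le_trans ?_ (le_iSup₂ θ hθ)
    refine le_trans ?_ (le_iSup₂ ρ hN)
    exact le_trans (le_iSup (fun a => ENNReal.ofReal (M.occupancy (softmaxPolicy θ) πstar ρ s a) /
      ENNReal.ofReal (M.occupancy (softmaxPolicy θ) (softmaxPolicy θ) ρ s a)) a)
      (le_iSup (fun s => ⨆ a, ENNReal.ofReal (M.occupancy (softmaxPolicy θ) πstar ρ s a) /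
        ENNReal.ofReal (M.occupancy (softmaxPolicy θ) (softmaxPolicy θ) ρ s a)) s)
  rw [ENNReal.div_le_iff_le_mul (Or.inr ENNReal.ofReal_ne_top) (Or.inl ENNReal.ofReal_ne_top),
    ← ENNReal.ofReal_mul hCov] at h1
  have h2 : 0 ≤ visitation M.discount (M.trans (softmaxPolicy θ)) (softmaxPolicy θ) ρ s *
      softmaxPolicy θ s a := mul_nonneg (visitation_nonneg M.discount_pos.le (M.trans_mem _ hπ) hπ
        hρ s) ((hπ s).1 a)
  rw [occupancy_eq, occupancy_eq, ENNReal.ofReal_le_ofReal_iff (by positivity),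
    mul_left_comm Cov] at h1
  exact le_of_mul_le_mul_left h1 hg

lemma norm_policy_sub_le_one {π π' : S → A → ℝ} (hπ : π ∈ Policies S A) (hπ' : π' ∈ Policies S A) :
    ‖π - π'‖ ≤ 1 :=
  norm_le_of_abs_le zero_le_one fun s a => by
    have h1 := (hπ s).1 a
    have h2 := (hπ' s).1 a
    have h3 := policy_le_one hπ s a
    have h4 := policy_le_one hπ' s a
    simp only [Pi.sub_apply]
    rw [abs_le]
    constructor <;> linarith

/-- Gradient domination up to the performative bias: the suboptimality is bounded by the derivative
in the direction of the ratio `u` of the occupancy measures. -/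
theorem softValue_sub_le [Nonempty S] [Nonempty A] {M : PeMDP S A}
    {Rmax Lr Lp R2 T2 lam : ℝ} (hM : M.IsSmooth Rmax Lr Lp R2 T2) (hR : 0 ≤ Rmax) (hLr : 0 ≤ Lr)
    (hLp : 0 ≤ Lp) (hR2 : 0 ≤ R2) (hT2 : 0 ≤ T2) (hlam : 0 ≤ lam)
    {Gr : (S → A → ℝ) → S → A → (S → A → ℝ)} {GP : (S → A → ℝ) → S → A → S → (S → A → ℝ)}
    (hG : M.HasLipschitzGradients Gr GP R2 T2) {ρ : S → ℝ} (hρ : ρ ∈ stdSimplex ℝ S)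
    {πstar : S → A → ℝ} (hπstar : πstar ∈ Policies S A) (θ u : EuclideanSpace ℝ (S × A)) {Cov : ℝ}
    (hu0 : ∀ i, 0 ≤ u i) (hu1 : ∀ i, u i ≤ Cov) (hCov : 0 ≤ Cov)
    (hu : ∀ s a, visitation M.discount (M.trans (softmaxPolicy θ)) πstar ρ s * πstar s a =
      visitation M.discount (M.trans (softmaxPolicy θ)) (softmaxPolicy θ) ρ s *
        (softmaxPolicy θ s a * u (s, a))) :
    M.softValue lam ρ πstar - M.softValue lam ρ (softmaxPolicy θ) ≤
      M.valueDeriv lam Gr GP ρ θ u + (1 + Cov) / (1 - M.discount) ^ 2 *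
        (Lr + Lp * (Rmax + lam * Real.log (Fintype.card A))) := by
  have hγ0 := M.discount_pos.le
  have hγ1 := M.discount_lt_one
  have hg : 0 < 1 - M.discount := by linarith
  have hπ := softmaxPolicy_mem θ
  have hpos := softmaxPolicy_pos θ
  rw [valueDeriv_apply, M.softValue_eq lam hρ hπ, M.softValue_eq lam hρ hπstar]
  have hvs := M.stateValue_eq lam hπstar
  have hv := M.stateValue_eq lam hπ
  have hvsb := PeMDP.abs_stateValue_le hM hlam hπstar
  have hvb := PeMDP.abs_stateValue_le hM hlam hπ
  set B := Rmax + lam * Real.log (Fintype.card A) with hB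
  have hB0 : 0 ≤ B := add_nonneg hR (mul_nonneg hlam (Real.log_nonneg IsMild.one_le_card))
  set π := softmaxPolicy θ
  set v := M.stateValue lam π
  set vs := M.stateValue lam πstar
  set P := M.trans π
  have hP : ∀ s a, P s a ∈ stdSimplex ℝ S := M.trans_mem π hπ
  set g := 1 - M.discount with hgdef
  have hBg : 0 ≤ B / g := by positivity
  set L := Lr + M.discount * Lp * (B / g) with hL
  have hL0 : 0 ≤ L := by positivity
  have hLg : L / g ≤ (Lr + Lp * B) / g ^ 2 := by
    have h1 : L ≤ (Lr + Lp * B) / g := by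
      have h2 : Lr ≤ Lr / g := by rw [le_div_iff₀ hg]; nlinarith
      have h3 : M.discount * Lp * (B / g) ≤ 1 * Lp * (B / g) := by gcongr
      have h4 : (Lr + Lp * B) / g = Lr / g + 1 * Lp * (B / g) := by ring
      linarith
    calc L / g ≤ (Lr + Lp * B) / g / g := by gcongr
      _ = _ := by field_simp
  have hq := fun {v : S → ℝ} (hv : ∀ s, |v s| ≤ B / g) => isSmoothPolicyFun_actionValue hM hG.reward
    hG.reward_lipschitz hG.trans hG.trans_lipschitz hBg hv
  -- The return of `πstar` in the environment of `π`, compared with that in its own environment.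
  set f : S → A → ℝ := fun s a => M.reward π s a - lam * Real.log (πstar s a) with hf
  have hA := discountedReturn_sub hγ0 hγ1 hP hπstar hρ f vs
  have hA' : |discountedReturn M.discount P πstar f ρ - ∑ s, ρ s * vs s| ≤ L / g := by
    rw [hA]
    refine abs_sum_visitation_mul_le hγ0 hγ1 hP hπstar hρ fun s => ?_
    rw [hvs s, ← actionMean_sub]
    refine abs_actionMean_le hπstar fun a => ?_
    have h1 := (hq hvsb s a).lipschitz π hπ πstar hπstar
    -- Both sides carry the same continuation values and the same entropy, so only the dependence of
    -- reward and kernel on the deployed policy is left.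
    have h2 : f s a + M.discount * lookahead P vs s a - M.softActionValue lam vs πstar s a =
        M.actionValue vs π s a - M.actionValue vs πstar s a := by
      simp only [hf, softActionValue, actionValue]; ring
    rw [h2]
    exact h1.trans (mul_le_of_le_one_right hL0 (norm_policy_sub_le_one hπ hπstar))
  -- The performance difference in the environment of `π`.
  have hD : discountedReturn M.discount P πstar f ρ - ∑ s, ρ s * v s ≤
      ∑ s, visitation M.discount P πstar ρ s *
        actionMean πstar (fun s a => M.softActionValue lam v π s a - v s) s := by
    rw [discountedReturn_sub hγ0 hγ1 hP hπstar hρ f v]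
    refine Finset.sum_le_sum fun s _ => mul_le_mul_of_nonneg_left ?_
      (visitation_nonneg hγ0 hP hπstar hρ s)
    have h1 := mul_le_mul_of_nonneg_left
      (sum_mul_log_sub_log_le (hπstar s) (hpos s) (hπ s).2) hlam
    have h2 : (fun s a => f s a + M.discount * lookahead P v s a) = fun s a =>
        M.softActionValue lam v π s a + lam * (Real.log (π s a) - Real.log (πstar s a)) := by
      funext s a
      simp only [hf, softActionValue, actionValue]
      ring
    rw [h2, actionMean_add, actionMean_smul, actionMean_sub πstar (M.softActionValue lam v π),
      actionMean_const hπstar]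
    have h3 : lam * actionMean πstar (fun s a => Real.log (π s a) - Real.log (πstar s a)) s ≤ 0 := by
      simpa [actionMean] using h1
    linarith
  -- Change of measure.
  set U : S → A → ℝ := fun s a => u (s, a)
  have hE : ∑ s, visitation M.discount P πstar ρ s *
        actionMean πstar (fun s a => M.softActionValue lam v π s a - v s) s =
      ∑ s, visitation M.discount P π ρ s * M.firstVariation lam Gr GP v π U s -
      ∑ s, visitation M.discount P π ρ s *
        actionMean π (fun s a => gradForm (M.actionValueGradient Gr GP v π s a)
          (fun s a => π s a * centered π U s a)) s := by
    rw [← Finset.sum_sub_distrib]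
    refine Finset.sum_congr rfl fun s _ => ?_
    -- Advantages have mean zero under π, so centring the ratio u does not change its pairing with
    -- them.
    have h0 : actionMean π (fun s a => M.softActionValue lam v π s a - v s) s = 0 := by
      rw [actionMean_sub, actionMean_const hπ, ← hv s, sub_self]
    have h1 : actionMean π (fun s a => centered π U s a * (M.softActionValue lam v π s a - v s)) s =
        actionMean π (fun s a => U s a * (M.softActionValue lam v π s a - v s)) s := by
      have e : actionMean π (fun s a => centered π U s a *
          (M.softActionValue lam v π s a - v s)) s =
          actionMean π (fun s a => U s a * (M.softActionValue lam v π s a - v s)) s -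
          actionMean π U s * actionMean π (fun s a => M.softActionValue lam v π s a - v s) s := by
        simp only [actionMean, centered, Finset.mul_sum _ _ (∑ a, π s a * U s a),
          ← Finset.sum_sub_distrib]
        exact Finset.sum_congr rfl fun a _ => by ring
      rw [e, h0]; ring
    rw [← mul_sub, firstVariation_eq hπ, h1, add_sub_cancel_right]
    simp only [actionMean, Finset.mul_sum]
    refine Finset.sum_congr rfl fun a _ => ?_
    rw [← mul_assoc, hu s a]
    ring
  -- The performative part of the derivative. Since u and its mean both lie in [0, Cov], the centred
  -- ratio is bounded by Cov, without the factor 2 of `abs_centered_le`.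
  have hbias : |∑ s, visitation M.discount P π ρ s *
        actionMean π (fun s a => gradForm (M.actionValueGradient Gr GP v π s a)
          (fun s a => π s a * centered π U s a)) s| ≤ L * Cov / g := by
    refine abs_sum_visitation_mul_le hγ0 hγ1 hP hπ hρ fun s => abs_actionMean_le hπ fun a => ?_
    refine abs_gradForm_centered_le hπ hL0 (by positivity) (hq hvb) hCov (fun s a => ?_) s a
    have h1 := actionMean_mono hπ (y := U) (z := fun _ _ => Cov) (s := s) fun a => hu1 (s, a)
    have h2 := actionMean_mono hπ (y := fun _ _ => 0) (z := U) (s := s) fun a => hu0 (s, a)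
    rw [actionMean_const hπ (fun _ => Cov)] at h1
    rw [actionMean_const hπ (fun _ => 0)] at h2
    have h3 := hu0 (s, a)
    have h4 := hu1 (s, a)
    simp only [centered, U] at h1 h2 ⊢
    rw [abs_le]
    constructor <;> linarith
  have hfin : L / g + L * Cov / g ≤ (1 + Cov) / g ^ 2 * (Lr + Lp * B) := by
    calc L / g + L * Cov / g = (1 + Cov) * (L / g) := by ring
      _ ≤ (1 + Cov) * ((Lr + Lp * B) / g ^ 2) := by gcongr
      _ = _ := by ring
  rw [abs_le] at hA' hbias
  linarith [hA'.1, hbias.1, hD, hE]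

lemma abs_softValue_le [Nonempty S] [Nonempty A] {M : PeMDP S A}
    {Rmax Lr Lp R2 T2 lam : ℝ} (hM : M.IsSmooth Rmax Lr Lp R2 T2) (hlam : 0 ≤ lam)
    {ρ : S → ℝ} (hρ : ρ ∈ stdSimplex ℝ S) {π : S → A → ℝ} (hπ : π ∈ Policies S A) :
    |M.softValue lam ρ π| ≤ (Rmax + lam * Real.log (Fintype.card A)) / (1 - M.discount) := by
  refine (congrArg _ (discountedReturn_eq M.discount_pos.le M.discount_lt_one (M.trans_mem π hπ) hπ
    hρ (M.softReward lam π))).trans_le ?_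
  exact abs_sum_visitation_mul_le M.discount_pos.le M.discount_lt_one (M.trans_mem π hπ) hπ hρ
    (abs_actionMean_softReward_le hM hlam hπ)

lemma exists_ratio_of_coverage [Nonempty A] {M : PeMDP S A} {ρ : S → ℝ} (hρ : ρ ∈ stdSimplex ℝ S)
    {πstar : S → A → ℝ} (hπstar : πstar ∈ Policies S A) {Θ : Set (EuclideanSpace ℝ (S × A))}
    {N : Set (S → ℝ)} (hN : ρ ∈ N) {Cov : ℝ} (hCov : 0 ≤ Cov)
    (h : M.coverage ρ πstar Θ N = ENNReal.ofReal Cov) {θ : EuclideanSpace ℝ (S × A)} (hθ : θ ∈ Θ) :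
    ∃ u : EuclideanSpace ℝ (S × A), (∀ i, 0 ≤ u i) ∧ (∀ i, u i ≤ Cov) ∧
      ∀ s a, visitation M.discount (M.trans (softmaxPolicy θ)) πstar ρ s * πstar s a =
        visitation M.discount (M.trans (softmaxPolicy θ)) (softmaxPolicy θ) ρ s *
          (softmaxPolicy θ s a * u (s, a)) := by
  have hπ := softmaxPolicy_mem θ
  have hP := M.trans_mem _ hπ
  have hle := visitation_mul_le_of_coverage hρ hN hCov h hθ
  set d : S → A → ℝ := fun s a =>
    visitation M.discount (M.trans (softmaxPolicy θ)) (softmaxPolicy θ) ρ s * softmaxPolicy θ s a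
    with hd
  set ds : S → A → ℝ := fun s a =>
    visitation M.discount (M.trans (softmaxPolicy θ)) πstar ρ s * πstar s a with hds
  have hd0 : ∀ s a, 0 ≤ d s a := fun s a =>
    mul_nonneg (visitation_nonneg M.discount_pos.le hP hπ hρ s) ((hπ s).1 a)
  have hds0 : ∀ s a, 0 ≤ ds s a := fun s a =>
    mul_nonneg (visitation_nonneg M.discount_pos.le hP hπstar hρ s) ((hπstar s).1 a)
  refine ⟨WithLp.toLp 2 fun i => ds i.1 i.2 / d i.1 i.2, fun i => div_nonneg (hds0 _ _) (hd0 _ _),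
    fun i => div_le_of_le_mul₀ (hd0 _ _) hCov (hle i.1 i.2), fun s a => ?_⟩
  rw [← mul_assoc]
  change ds s a = d s a * (ds s a / d s a)
  -- Where the denominator vanishes the real quotient is 0, which is the right value because
  -- coverage makes the numerator vanish too.
  rcases eq_or_ne (d s a) 0 with h0 | h0
  · have h1 : ds s a ≤ Cov * d s a := hle s a
    rw [h0, mul_zero] at h1
    rw [h0, zero_mul]
    exact le_antisymm h1 (hds0 s a)
  · field_simp

lemma norm_le_of_mem_Icc {ι : Type*} [Fintype ι] {u : EuclideanSpace ℝ ι} {c : ℝ}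
    (h0 : ∀ i, 0 ≤ u i) (h1 : ∀ i, u i ≤ c) : ‖u‖ ^ 2 ≤ Fintype.card ι * c ^ 2 := by
  rw [EuclideanSpace.norm_sq_eq]
  calc ∑ i, ‖u i‖ ^ 2 ≤ ∑ _i : ι, c ^ 2 := Finset.sum_le_sum fun i _ => by
        rw [Real.norm_eq_abs, abs_of_nonneg (h0 i)]
        exact pow_le_pow_left₀ (h0 i) (h1 i) 2
    _ = Fintype.card ι * c ^ 2 := by rw [Finset.sum_const, Finset.card_univ, nsmul_eq_mul]

/-- Gradient ascent on the soft value reaches the performative bias. -/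
theorem exists_softValue_sub_le [Nonempty S] [Nonempty A] {M : PeMDP S A}
    {Rmax Lr Lp R2 T2 lam κ : ℝ} (hM : M.IsSmooth Rmax Lr Lp R2 T2) (hR : 0 < Rmax) (hLr : 0 ≤ Lr)
    (hLp : 0 ≤ Lp) (hR2 : 0 ≤ R2) (hT2 : 0 ≤ T2) (hlam0 : 0 ≤ lam)
    (hlam : lam * (1 + 2 * Real.log (Fintype.card A)) ≤ (1 - M.discount) * Rmax)
    (hκ0 : 0 < κ) (hκ : κ ≤ 1 / (2 * (648 * Rmax + 16 * R2 + 32 * T2 * Rmax)))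
    {ρ : S → ℝ} (hρ : ρ ∈ stdSimplex ℝ S) (θ₀ : EuclideanSpace ℝ (S × A)) {ε : ℝ} (hε : 0 < ε)
    {η : ℝ} (hη : η = κ * (1 - M.discount) ^ 2 / Fintype.card A)
    {πstar : S → A → ℝ} (hπstar : πstar ∈ Policies S A)
    (hmax : IsMaxOn (M.softValue lam ρ) (Policies S A) πstar) {T : ℕ} (hT : 1 ≤ T)
    {Θ : Set (EuclideanSpace ℝ (S × A))} {N : Set (S → ℝ)}
    (hΘ : ∀ t < T, gradientAscent (M.softValue lam ρ) η θ₀ t ∈ Θ) (hN : ρ ∈ N)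
    {Cov : ℝ} (hcov : M.coverage ρ πstar Θ N = ENNReal.ofReal Cov) (hCov : 0 ≤ Cov)
    (hTC : 6 * Rmax / κ * (Fintype.card S * (Fintype.card A : ℝ) ^ 2 * Cov ^ 2 /
      (ε ^ 2 * (1 - M.discount) ^ 3)) ≤ (T : ℝ)) :
    ∃ t < T, M.softValue lam ρ πstar -
        M.softValue lam ρ (softmaxPolicy (gradientAscent (M.softValue lam ρ) η θ₀ t)) ≤
      ε + (1 + Cov) / (1 - M.discount) ^ 2 *
        (Lr + Lp * (Rmax + lam * Real.log (Fintype.card A))) := by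
  have hγ0 := M.discount_pos.le
  have hγ1 := M.discount_lt_one
  have hg : 0 < 1 - M.discount := by linarith
  have hcard := IsMild.one_le_card (A := A)
  have hlog : 0 ≤ lam * Real.log (Fintype.card A) := mul_nonneg hlam0 (Real.log_nonneg hcard)
  have hB : Rmax + lam * Real.log (Fintype.card A) ≤ 3 / 2 * Rmax := by
    have := mul_pos M.discount_pos hR
    linarith
  -- The choice of λ keeps λ log |A| ≤ R_max/2, so values lie within (3/2) R_max/(1-γ) of zero.
  have hrange : ∀ θ : EuclideanSpace ℝ (S × A), M.softValue lam ρ πstar -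
      M.softValue lam ρ (softmaxPolicy θ) ≤ 3 * Rmax / (1 - M.discount) := fun θ => by
    have h1 := (abs_le.1 (abs_softValue_le hM hlam0 hρ hπstar)).2
    have h2 := (abs_le.1 (abs_softValue_le hM hlam0 hρ (softmaxPolicy_mem θ))).1
    have h3 : (Rmax + lam * Real.log (Fintype.card A)) / (1 - M.discount) ≤
        3 / 2 * Rmax / (1 - M.discount) := by gcongr
    have h4 : 3 * Rmax / (1 - M.discount) = 2 * (3 / 2 * Rmax / (1 - M.discount)) := by ring
    linarith
  -- The threshold 3 matches the range: beyond it the bias alone reaches 3 R_max/(1-γ), and t = 0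
  -- suffices.
  by_cases hmild : Lr ≤ 3 * Rmax * (1 - M.discount) ∧ Lp ≤ 3 * (1 - M.discount)
  · obtain ⟨Gr, hGr⟩ := hM.reward_smooth
    obtain ⟨GP, hGP⟩ := hM.trans_smooth
    have hG : M.HasLipschitzGradients Gr GP R2 T2 := ⟨hGr.1, hGr.2, hGP.1, hGP.2⟩
    have hMild : M.IsMild Rmax Lr Lp R2 T2 lam :=
      ⟨hM, hR, hLp, hR2, hT2, hmild.1, hmild.2, hlam0, hlam⟩
    have hrem := abs_remainder_le_of_local (f := fun θ => M.softValue lam ρ (softmaxPolicy θ))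
      (D := M.valueDeriv lam Gr GP ρ)
      fun θ h hh => hMild.abs_softValue_remainder_le hG hρ θ h hh
    set β := 648 * Rmax + 16 * R2 + 32 * T2 * Rmax with hβ
    have hβ0 : 0 < β := by positivity
    have hη0 : 0 < η := by rw [hη]; positivity
    have hηβ : η * (β * Fintype.card A / (1 - M.discount) ^ 2) ≤ 1 / 2 := by
      have h1 : η * (β * Fintype.card A / (1 - M.discount) ^ 2) = κ * β := by
        rw [hη]; field_simp
      rw [h1]
      calc κ * β ≤ 1 / (2 * β) * β := by gcongr
        _ = 1 / 2 := by field_simp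
    obtain ⟨t, ht, hgrad⟩ := exists_norm_gradient_le hη0.le hηβ hrem
      (x := gradientAscent (M.softValue lam ρ) η θ₀) (fun t => rfl)
      (fun θ => hmax (softmaxPolicy_mem θ)) hT
    refine ⟨t, ht, ?_⟩
    obtain ⟨u, hu0, hu1, hu⟩ := exists_ratio_of_coverage hρ hπstar hN hCov hcov (hΘ t ht)
    have hdom := softValue_sub_le hM hR.le hLr hLp hR2 hT2 hlam0 hG hρ hπstar _ u hu0 hu1 hCov hu
    refine hdom.trans (add_le_add_left ?_ _)
    rw [← inner_gradient_eq (f := fun θ => M.softValue lam ρ (softmaxPolicy θ)) hrem]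
    set G := gradient (fun θ => M.softValue lam ρ (softmaxPolicy θ))
      (gradientAscent (M.softValue lam ρ) η θ₀ t)
    refine (real_inner_le_norm _ _).trans (le_of_sq_le_sq ?_ hε.le)
    have hT0 : (0 : ℝ) < T := by exact_mod_cast hT
    have h1 := hgrad.trans (hrange _)
    -- The range 3 R_max/(1-γ) divided by Tη/2, with η inserted.
    have h2 : ‖G‖ ^ 2 ≤ 6 * Rmax * Fintype.card A / (κ * (1 - M.discount) ^ 3 * T) := by
      rw [le_div_iff₀ (by positivity)]
      rw [hη, le_div_iff₀ hg] at h1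
      have hA : (0 : ℝ) < Fintype.card A := by linarith
      have e : (T : ℝ) * (κ * (1 - M.discount) ^ 2 / Fintype.card A / 2 * ‖G‖ ^ 2) *
          (1 - M.discount) = ‖G‖ ^ 2 * (κ * (1 - M.discount) ^ 3 * T) / (2 * Fintype.card A) := by
        field_simp
      rw [e, div_le_iff₀ (by positivity)] at h1
      linarith
    have h3 := norm_le_of_mem_Icc hu0 hu1
    rw [Fintype.card_prod, Nat.cast_mul] at h3
    rw [mul_pow]
    calc ‖G‖ ^ 2 * ‖u‖ ^ 2 ≤ 6 * Rmax * Fintype.card A / (κ * (1 - M.discount) ^ 3 * T) *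
          (Fintype.card S * Fintype.card A * Cov ^ 2) := by gcongr
      _ = 6 * Rmax / κ * (Fintype.card S * (Fintype.card A : ℝ) ^ 2 * Cov ^ 2 /
            (ε ^ 2 * (1 - M.discount) ^ 3)) * (ε ^ 2 / T) := by field_simp
      _ ≤ T * (ε ^ 2 / T) := by gcongr
      _ = ε ^ 2 := by field_simp
  · refine ⟨0, by omega, (hrange _).trans ?_⟩
    have h1 : 3 * Rmax * (1 - M.discount) ≤ Lr + Lp * Rmax := by
      rw [not_and_or, not_le, not_le] at hmild
      rcases hmild with h | h
      · have := mul_nonneg hLp hR.le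
        linarith
      · have := mul_le_mul_of_nonneg_right h.le hR.le
        linarith
    have h2 : Lp * Rmax ≤ Lp * (Rmax + lam * Real.log (Fintype.card A)) := by
      gcongr; linarith
    have h3 : 3 * Rmax / (1 - M.discount) =
        1 / (1 - M.discount) ^ 2 * (3 * Rmax * (1 - M.discount)) := by field_simp
    have h4 : 1 / (1 - M.discount) ^ 2 * (3 * Rmax * (1 - M.discount)) ≤
        (1 + Cov) / (1 - M.discount) ^ 2 *
          (Lr + Lp * (Rmax + lam * Real.log (Fintype.card A))) := by
      gcongr
      · linarith
      · linarith
    linarith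

lemma softValue_zero (M : PeMDP S A) (ρ : S → ℝ) : M.softValue 0 ρ = M.value ρ := by
  funext π
  simp only [softValue, value, zero_mul, sub_zero]

end PeMDP

end GradientDomination

/-! ### The two objectives -/

theorem theorem2 (Rmax Lr Lp R2 T2 : ℝ) (hR : 0 < Rmax) (hLr : 0 ≤ Lr) (hLp : 0 ≤ Lp)
    (hR2 : 0 ≤ R2) (hT2 : 0 ≤ T2) :
    ∃ c : ℝ, 0 < c ∧ ∀ κ : ℝ, 0 < κ → κ ≤ c → ∃ C : ℝ, 0 < C ∧
      ∀ (S A : Type*) [Fintype S] [Fintype A] [Nonempty S] [Nonempty A] (M : PeMDP S A),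
        M.IsSmooth Rmax Lr Lp R2 T2 →
        ∀ ρ ∈ stdSimplex ℝ S, ∀ (θ₀ : EuclideanSpace ℝ (S × A)) (ε : ℝ), 0 < ε →
        ∀ η : ℝ, η = κ * (1 - M.discount) ^ 2 / Fintype.card A →
        -- (a) the unregularised objective
        (∀ πstar : S → A → ℝ, πstar ∈ Policies S A → IsMaxOn (M.value ρ) (Policies S A) πstar →
          ∀ T : ℕ, 1 ≤ T →
          ∀ (Θ : Set (EuclideanSpace ℝ (S × A))) (N : Set (S → ℝ)),
            (∀ t < T, PeMDP.gradientAscent (M.value ρ) η θ₀ t ∈ Θ) →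
            ρ ∈ N → N ⊆ stdSimplex ℝ S →
          ∀ Cov : ℝ, M.coverage ρ πstar Θ N = ENNReal.ofReal Cov → 0 ≤ Cov →
            C * (Fintype.card S * (Fintype.card A : ℝ) ^ 2 * Cov ^ 2 /
              (ε ^ 2 * (1 - M.discount) ^ 3)) ≤ (T : ℝ) →
            ∃ t < T,
              M.value ρ πstar -
                  M.value ρ (softmaxPolicy (PeMDP.gradientAscent (M.value ρ) η θ₀ t)) ≤
                ε + √2 * (1 + Cov) / (1 - M.discount) ^ 2 * (Lr + Lp * Rmax)) ∧
        -- (b) the entropy-regularised objective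
        (∀ lam : ℝ, lam = (1 - M.discount) * Rmax / (1 + 2 * Real.log (Fintype.card A)) →
          ∀ πstar : S → A → ℝ, πstar ∈ Policies S A →
            IsMaxOn (M.softValue lam ρ) (Policies S A) πstar →
          ∀ T : ℕ, 1 ≤ T →
          ∀ (Θ : Set (EuclideanSpace ℝ (S × A))) (N : Set (S → ℝ)),
            (∀ t < T, PeMDP.gradientAscent (M.softValue lam ρ) η θ₀ t ∈ Θ) →
            ρ ∈ N → N ⊆ stdSimplex ℝ S →
          ∀ Cov : ℝ, M.coverage ρ πstar Θ N = ENNReal.ofReal Cov → 0 ≤ Cov →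
            C * (Fintype.card S * (Fintype.card A : ℝ) ^ 2 * Cov ^ 2 /
              (ε ^ 2 * (1 - M.discount) ^ 3)) ≤ (T : ℝ) →
            ∃ t < T,
              M.softValue lam ρ πstar -
                  M.softValue lam ρ
                    (softmaxPolicy (PeMDP.gradientAscent (M.softValue lam ρ) η θ₀ t)) ≤
                ε + √2 * (2 + Cov) / (1 - M.discount) ^ 2 *
                  (Lr + Lp * (Rmax + lam * Real.log (Fintype.card A)))) := by
  -- c makes η times the smoothness constant at most 1/2, and C = 6 R_max/κ is the constant of the
  -- gradient bound. The argument yields the factor 1 + Cov in both parts; √2 and 2 + Cov are only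
  -- slack.
  refine ⟨1 / (2 * (648 * Rmax + 16 * R2 + 32 * T2 * Rmax)), by positivity,
    fun κ hκ0 hκ => ⟨6 * Rmax / κ, by positivity, ?_⟩⟩
  intro S A _ _ _ _ M hM ρ hρ θ₀ ε hε η hη
  have hg : 0 < 1 - M.discount := by linarith [M.discount_lt_one]
  have hcard : (1 : ℝ) ≤ Fintype.card A := PeMDP.IsMild.one_le_card
  have hlog : 0 ≤ Real.log (Fintype.card A) := Real.log_nonneg hcard
  have hsqrt : 1 ≤ √(2 : ℝ) := Real.one_le_sqrt.2 (by norm_num)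
  constructor
  · intro πstar hπstar hmax T hT Θ N hΘ hN _ Cov hcov hCov hTC
    rw [← M.softValue_zero] at hmax hΘ ⊢
    obtain ⟨t, ht, hle⟩ := PeMDP.exists_softValue_sub_le hM hR hLr hLp hR2 hT2 le_rfl
      (by rw [zero_mul]; positivity) hκ0 hκ hρ θ₀ hε hη hπstar hmax hT hΘ hN hcov hCov hTC
    refine ⟨t, ht, hle.trans ?_⟩
    rw [zero_mul, add_zero]
    gcongr
    nlinarith
  · intro lam hlam πstar hπstar hmax T hT Θ N hΘ hN _ Cov hcov hCov hTC
    have hlam0 : 0 ≤ lam := by rw [hlam]; positivity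
    obtain ⟨t, ht, hle⟩ := PeMDP.exists_softValue_sub_le hM hR hLr hLp hR2 hT2 hlam0
      (by rw [hlam, div_mul_cancel₀ _ (by positivity)]) hκ0 hκ hρ θ₀ hε hη hπstar hmax hT hΘ hN
      hcov hCov hTC
    refine ⟨t, ht, hle.trans ?_⟩
    gcongr
    nlinarith
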